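/- Let $X$ be a Noetherian scheme. We use the following terminology. - A morphism $g:U\to V$ is a *universal homeomorphism* if $U\times_VW\to W$ is a homeomorphism for every $W\to V$. - Let $Z\subset X$ be a closed, nowhere dense subset. A *finite modification* of $X$ centered at $Z$ is a finite morphism $p:Y\to X$ such that no associated point of $Y$ lies in $p^{-1}(Z)$ and $p$ is an isomorphism over $X\setminus Z$. The scheme $X$ is *topologically normal* if, for every closed, nowhere dense $Z\subset X$, every finite modification of $X$ centered at $Z$ is a universal homeomorphism. - A local ring $A$ is *geometrically unibranch* if $A_{\rm red}$ is a domain, the integral closure $A'$ of $A_{\rm red}$ in its fraction field is local, and the residue field of $A'$ is purely inseparable over that of $A$. The scheme $X$ is *geometrically unibranch* if all its local rings are. - The *normalization* $X^{\rm n}\to X$ is the normalization of $X_{\rm red}$, that is, the relative normalization of $X$ in $\coprod_\eta \operatorname{Spec}\kappa(\eta)$, where $\eta$ runs through the generic points of the irreducible components of $X$. - A *partial weak normalization* of $X$ is an integral morphism $g:X'\to X$ such that $X'$ is reduced, $X'\to X_{\rm red}$ is birational (it induces a bijection on generic points of irreducible components and isomorphisms of the local rings there), and for every $x\in X$ the reduced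 fiber of $g$ over $x$ is a single point whose residue field is purely inseparable over $\kappa(x)$. The *weak normalization* $X^{\rm wn}\to X$ is the largest partial weak normalization: the one that factors through every other one. - A scheme is *normal* if all its local rings are integrally closed domains. Then the weak normalization $X^{\rm wn}\to X$ exists, and the following are equivalent: 1. $X$ is topologically normal; 2. $X$ is geometrically unibranch; 3. the normalization $X^{\rm n}\to X$ is a universal homeomorphism; 4. the weak normalization $X^{\rm wn}$ is normal. -/

import Mathlib

open AlgebraicGeometry CategoryTheory CategoryTheory.Limits TopologicalSpace

universe u

noncomputable section

namespace TopNormal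

/-! ### Universal homeomorphisms -/

/-- A morphism `g : U ⟶ V` of schemes is a universal homeomorphism if for every `W ⟶ V` the
projection `U ×[V] W ⟶ W` is a homeomorphism. -/
def IsUniversalHomeomorphism {U V : Scheme.{u}} (g : U ⟶ V) : Prop :=
  MorphismProperty.universally (topologically @IsHomeomorph) g

/-! ### Finite modifications and topological normality -/

/-- `y` is an associated point of `Y`: the maximal ideal of `𝒪_{Y,y}` is an associated prime of
`𝒪_{Y,y}`. (This is used for locally Noetherian `Y` only.) -/
def IsAssociatedPoint (Y : Scheme.{u}) (y : Y) : Prop :=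
  IsAssociatedPrime (IsLocalRing.maximalIdeal (Y.presheaf.stalk y)) (Y.presheaf.stalk y)

/-- A finite modification of `X` centered at the closed set `Z`: a finite morphism `p : Y ⟶ X`
that is an isomorphism over `X ∖ Z` and such that no associated point of `Y` lies in `p⁻¹(Z)`.
(The scheme structure of a closed subscheme `Z` plays no role in this notion.) -/
structure IsFiniteModification {X Y : Scheme.{u}} (p : Y ⟶ X) (Z : Closeds X) : Prop where
  isFinite : IsFinite p
  notMem_of_isAssociatedPoint : ∀ y : Y, IsAssociatedPoint Y y → p y ∉ Z
  isIso_restrict : IsIso (p ∣_ (Z.compl : X.Opens))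

/-- The pair `Z ⊂ X` is topologically normal: every finite modification of `X` centered at `Z` is
a universal homeomorphism. -/
def IsTopologicallyNormalPair (X : Scheme.{u}) (Z : Closeds X) : Prop :=
  ∀ (Y : Scheme.{u}) (p : Y ⟶ X), IsFiniteModification p Z → IsUniversalHomeomorphism p

/-- `X` is topologically normal: the pair `Z ⊂ X` is topologically normal for every closed,
nowhere dense `Z`. -/
def IsTopologicallyNormal (X : Scheme.{u}) : Prop :=
  ∀ Z : Closeds X, IsNowhereDense (Z : Set X) → IsTopologicallyNormalPair X Z

/-! ### Geometrically unibranch schemes -/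

/-- The reduction `A_red` of a ring. -/
abbrev Red (A : Type u) [CommRing A] : Type u := A ⧸ nilradical A

/-- The integral closure of `A_red` in its ring of fractions. -/
abbrev RedNormalization (A : Type u) [CommRing A] : Type u :=
  integralClosure (Red A) (FractionRing (Red A))

/-- The canonical homomorphism from `A` to the integral closure of `A_red`. -/
def toRedNormalization (A : Type u) [CommRing A] : A →+* RedNormalization A :=
  (algebraMap (Red A) (RedNormalization A)).comp (Ideal.Quotient.mk (nilradical A))

/-- A local ring `A` is geometrically unibranch if `A_red` is a domain, the integral closure `A'`
of `A_red` in its fraction field is local, and the residue field of `A'` is purely inseparable over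
the residue field of `A`. (The homomorphism `A → A'` is then automatically local.) -/
def IsGeometricallyUnibranchRing (A : Type u) [CommRing A] [IsLocalRing A] : Prop :=
  IsDomain (Red A) ∧
    ∃ (_ : IsLocalRing (RedNormalization A)) (_ : IsLocalHom (toRedNormalization A)),
      (IsLocalRing.ResidueField.map (toRedNormalization A)).IsPurelyInseparable

/-- A scheme is geometrically unibranch if all its local rings are. -/
def IsGeometricallyUnibranch (X : Scheme.{u}) : Prop :=
  ∀ x : X, IsGeometricallyUnibranchRing (X.presheaf.stalk x)

/-! ### Normal schemes and the normalization -/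

/-- A scheme is normal if all its local rings are integrally closed domains. -/
def IsNormal (X : Scheme.{u}) : Prop :=
  ∀ x : X, IsDomain (X.presheaf.stalk x) ∧ IsIntegrallyClosed (X.presheaf.stalk x)

/-- The disjoint union of the spectra of the residue fields at the generic points of the
irreducible components of `X`. -/
def genericScheme (X : Scheme.{u}) : Scheme.{u} :=
  ∐ fun η : genericPoints X ↦ Spec (X.residueField η.1)

/-- The canonical morphism `∐ Spec κ(η) ⟶ X`. -/
def genericSchemeMap (X : Scheme.{u}) : genericScheme X ⟶ X :=
  Sigma.desc fun η : genericPoints X ↦ X.fromSpecResidueField η.1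

theorem finite_genericPoints (X : Scheme.{u}) [IsNoetherian X] : Finite (genericPoints X) := by
  have : Finite (irreducibleComponents X) :=
    (finite_irreducibleComponents_of_isNoetherian (X := X)).to_subtype
  exact Finite.of_injective (fun η ↦ (⟨closure {η.1}, η.2⟩ : irreducibleComponents X))
    fun a b h ↦ Subtype.ext (IsGenericPoint.eq rfl (congrArg Subtype.val h).symm)

instance (X : Scheme.{u}) [IsNoetherian X] : CompactSpace (genericScheme X) := by
  have := finite_genericPoints X
  unfold genericScheme
  infer_instance

instance (X : Scheme.{u}) [IsNoetherian X] : QuasiCompact (genericSchemeMap X) := by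
  infer_instance

instance (X : Scheme.{u}) [IsNoetherian X] : QuasiSeparated (genericSchemeMap X) := by
  have : IsLocallyNoetherian (genericScheme X) :=
    (isLocallyNoetherian_iff_openCover
      (sigmaOpenCover fun η : genericPoints X ↦ Spec (X.residueField η.1))).2 fun η ↦
        (inferInstance : IsLocallyNoetherian (Spec (X.residueField η.1)))
  infer_instance

/-- The normalization of a Noetherian scheme `X`: the relative normalization of `X` in
`∐ Spec κ(η)`, where `η` runs through the generic points of the irreducible components of `X`.
This is the normalization of the reduction of `X`. -/
def normalization (X : Scheme.{u}) [IsNoetherian X] : Scheme.{u} :=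
  (genericSchemeMap X).normalization

/-- The normalization morphism. -/
def normalizationMap (X : Scheme.{u}) [IsNoetherian X] : normalization X ⟶ X :=
  (genericSchemeMap X).fromNormalization

/-! ### The weak normalization -/

/-- A partial normalization of `X`: an integral morphism `g : X' ⟶ X` with `X'` reduced and
`X' ⟶ X_red` birational. The latter means that `g` induces a bijection between the generic points
of the irreducible components of `X'` and of `X`, and isomorphisms of the local rings of `X'` and
`X_red` there; these local rings are the residue fields. -/
structure IsPartialNormalization {X' X : Scheme.{u}} (g : X' ⟶ X) : Prop where
  isReduced : IsReduced X'
  isIntegralHom : IsIntegralHom g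
  bijOn_genericPoints : Set.BijOn g (genericPoints X') (genericPoints X)
  bijective_residueFieldMap : ∀ x ∈ genericPoints X', Function.Bijective (g.residueFieldMap x)

/-- A partial weak normalization: a partial normalization `g : X' ⟶ X` such that for every `x : X`
the reduced fiber over `x` is a single point, whose residue field is a purely inseparable extension
of that of `x`. -/
structure IsPartialWeakNormalization {X' X : Scheme.{u}} (g : X' ⟶ X) : Prop extends
    IsPartialNormalization g where
  bijective : Function.Bijective g
  isPurelyInseparable : ∀ x' : X', (g.residueFieldMap x').hom.IsPurelyInseparable

/-- `g : W ⟶ X` is the weak normalization of `X`: it is the largest partial weak normalization,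
that is, it dominates (factors through) every other one. -/
structure IsWeakNormalization {W X : Scheme.{u}} (g : W ⟶ X) : Prop extends
    IsPartialWeakNormalization g where
  dominates : ∀ (X' : Scheme.{u}) (g' : X' ⟶ X), IsPartialWeakNormalization g' →
    ∃ h : W ⟶ X', h ≫ g' = g

end TopNormal

end

noncomputable section

namespace TopNormal

/-! ### Relative spectra of quasi-coherent subalgebras -/

open Scheme.AffineZariskiSite

/-! Every condition is compared with condition 3. Over an affine open `U` put `R = Γ(X, U)` and let
`Q` be the ring of sections of `∐ Spec κ(η)` over `U`. It is a finite product of fields, its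
elements are fractions of elements of `R`, and the kernel of `R → Q` is nil. The normalization over
`U` is the integral closure `R'` of `R` in `Q`. The normalization map is integral and surjective, so
it is a universal homeomorphism exactly when, for every `U`, field-valued points of `R'` that agree
on `R` are equal (`PointInjective`).

Existence of the weak normalization, and 3 ⇔ 4. The weak closure consists of the elements of `R'`
that do not separate field-valued points agreeing on `R`. It is compatible with localization
(`exists_pow_mul_mem_weakClosure`), so it has a relative spectrum over `X`. By lying over it is
itself injective on points, and every integral algebra that is injective on points maps into it;
hence it gives the largest partial weak normalization. Condition 3 says that the weak closure is all
of `R'`. As `Q` is a product of fields, this amounts to the local rings of the weak closure being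
integrally closed domains (`isNormal_weakNormalization_iff`).

2 ⇔ 3. Being geometrically unibranch is also a statement about field-valued points, namely those
over the closed point of the local ring. Since integral closure commutes with localization, the
condition at `x` is the part of condition 3 that concerns points over `x`
(`isGeometricallyUnibranch_iff`).

3 ⇒ 1. The generic points of a finite modification `Y` are associated, so they lie where `Y → X` is
an isomorphism. Therefore the normalization maps onto `Y`, and universal injectivity descends to `Y
→ X`.

1 ⇒ 3. Let `b = a / s` be integral over `R`, and lift it to a fraction `c` in `R_s` whose powers
have a common denominator `s ^ n`. The ideal `I` of all `r` with every `r * c ^ k` in the image of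
`R` contains `s ^ n`, and `c` multiplies `I` into itself. Extend `I` to an ideal sheaf that is
trivial off the closure `Z` of the locus in `U` where `s` vanishes. The functions on `X ∖ Z` that
multiply this ideal sheaf into itself form a finite modification centered at `Z`, with `c` among its
sections. By condition 1 it is injective on points, which puts `b` in the weak closure. -/

/-- An element of `S'` is a fraction with numerator in `Q`; by `hpow` a further power of `h` moves
the numerator into `S`. -/
lemma isLocalization_away_restrict {Q Q' : Type u} [CommRing Q] [CommRing Q'] (ρ : Q →+* Q')
    (S : Subring Q) (S' : Subring Q') (hS : ∀ t ∈ S, ρ t ∈ S') (h : Q) (hh : h ∈ S)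
    (hloc : letI := ρ.toAlgebra; IsLocalization.Away h Q')
    (hunit : ∃ u ∈ S', ρ h * u = 1) (hpow : ∀ t, ρ t ∈ S' → ∃ n : ℕ, h ^ n * t ∈ S) :
    letI := (ρ.restrict S S' hS).toAlgebra
    IsLocalization.Away (⟨h, hh⟩ : S) S' := by
  let := (ρ.restrict S S' hS).toAlgebra
  let := ρ.toAlgebra
  obtain ⟨u, huS, hu⟩ := hunit
  refine IsLocalization.Away.mk _ ?_ ?_ ?_
  · exact IsUnit.of_mul_eq_one ⟨u, huS⟩ (Subtype.ext hu)
  · rintro ⟨s, hs⟩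
    obtain ⟨n, a, ha⟩ := IsLocalization.Away.surj h s
    change s * ρ h ^ n = ρ a at ha
    obtain ⟨m, hm⟩ := hpow a (ha ▸ mul_mem hs (pow_mem (hS h hh) n))
    refine ⟨m + n, ⟨h ^ m * a, hm⟩, Subtype.ext ?_⟩
    change s * ρ h ^ (m + n) = ρ (h ^ m * a)
    rw [map_mul, ← ha, map_pow]
    ring
  · rintro ⟨a, ha⟩ ⟨b, hb⟩ hab
    obtain ⟨n, hn⟩ := IsLocalization.Away.exists_of_eq (S := Q') h
      (show algebraMap Q Q' a = algebraMap Q Q' b from congr($(hab).1))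
    exact ⟨n, Subtype.ext hn⟩

lemma comp_pullbackRestrictIsoRestrict_hom {X Y : Scheme.{u}} (f : X ⟶ Y) {U V : Y.Opens}
    (h : U ≤ V) (t : pullback f U.ι ⟶ pullback f V.ι)
    (ht : t ≫ pullback.fst f V.ι = pullback.fst f U.ι) :
    t ≫ (pullbackRestrictIsoRestrict f V).hom =
      (pullbackRestrictIsoRestrict f U).hom ≫ X.homOfLE (f.preimage_mono h) := by
  rw [← cancel_mono (Scheme.Opens.ι _), Category.assoc, Category.assoc, Scheme.homOfLE_ι,
    pullbackRestrictIsoRestrict_hom_ι, pullbackRestrictIsoRestrict_hom_ι, ht]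

lemma appLE_of_ι_comp_eq {T Z : Scheme.{u}} (V : T.Opens) {A : CommRingCat.{u}} (φ : A ⟶ Γ(T, V))
    (g : Spec A ⟶ Z) (h : T ⟶ Z) (e : V.ι ≫ h = V.toSpecΓ ≫ Spec.map φ ≫ g) (W : Z.Opens)
    (hW : ⊤ ≤ g ⁻¹ᵁ W) (hV : V ≤ h ⁻¹ᵁ W) :
    h.appLE W V hV = g.appLE W ⊤ hW ≫ (Scheme.ΓSpecIso A).hom ≫ φ := by
  have h1 : V.ι.appLE V ⊤ (by simp) = V.topIso.inv := by
    rw [Scheme.Hom.appLE, Scheme.Opens.ι_app]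
    exact (T.presheaf.map_comp _ _).symm
  have h2 : (V.toSpecΓ ≫ Spec.map φ).appLE ⊤ ⊤ (Scheme.Hom.preimage_top _).ge =
      (Scheme.ΓSpecIso A).hom ≫ φ ≫ V.topIso.inv := by
    refine (Scheme.Hom.app_eq_appLE _).symm.trans ?_
    rw [Scheme.Hom.comp_app]
    change (Spec.map φ).appTop ≫ V.toSpecΓ.appTop = _
    rw [Scheme.Opens.toSpecΓ_appTop, ← Category.assoc, Scheme.ΓSpecIso_naturality, Category.assoc]
  have h4 : ⊤ ≤ (V.toSpecΓ ≫ Spec.map φ ≫ g) ⁻¹ᵁ W := by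
    rw [top_le_iff] at hW
    rw [← Category.assoc, Scheme.Hom.comp_preimage, hW]
    exact le_top
  have h3 : (V.toSpecΓ ≫ Spec.map φ ≫ g).appLE W ⊤ h4 =
      g.appLE W ⊤ hW ≫ (Scheme.ΓSpecIso A).hom ≫ φ ≫ V.topIso.inv := by
    rw [← h2, Scheme.Hom.appLE_comp_appLE]
    simp_rw [Category.assoc]
  rw [← cancel_mono V.topIso.inv, ← h1, Scheme.Hom.appLE_comp_appLE]
  simp_rw [e]
  rw [h3, h1, Category.assoc, Category.assoc]

/-- A quasi-coherent `𝒪_X`-subalgebra of `f_* 𝒪_T`, given by its sections over affine opens. -/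
structure QCohSubalgebra {T X : Scheme.{u}} (f : T ⟶ X) where
  /-- The sections over an affine open. -/
  sections (U : X.AffineZariskiSite) : Subring Γ(T, f ⁻¹ᵁ U.1)
  app_mem (U : X.AffineZariskiSite) (r : Γ(X, U.1)) : f.app U.1 r ∈ sections U
  map_mem (U : X.AffineZariskiSite) (h : Γ(X, U.1)) (t : Γ(T, f ⁻¹ᵁ U.1)) : t ∈ sections U →
    T.presheaf.map (homOfLE (f.preimage_mono (X.basicOpen_le h))).op t ∈ sections (U.basicOpen h)
  exists_pow_mul_mem (U : X.AffineZariskiSite) (h : Γ(X, U.1)) (t : Γ(T, f ⁻¹ᵁ U.1)) :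
    T.presheaf.map (homOfLE (f.preimage_mono (X.basicOpen_le h))).op t ∈ sections (U.basicOpen h) →
    ∃ n : ℕ, f.app U.1 h ^ n * t ∈ sections U

namespace QCohSubalgebra

variable {T X : Scheme.{u}} {f : T ⟶ X} (S : QCohSubalgebra f)

lemma map_mem' {U V : X.AffineZariskiSite} (i : V ⟶ U) (t : Γ(T, f ⁻¹ᵁ U.1))
    (ht : t ∈ S.sections U) :
    T.presheaf.map (homOfLE (f.preimage_mono (toOpens_mono i.le))).op t ∈ S.sections V := by
  obtain ⟨h, hh⟩ := i.le
  obtain rfl : V = U.basicOpen h := Subtype.ext hh.symm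
  exact S.map_mem U h t ht

/-- The inclusion of the sections. -/
def incl (U : X.AffineZariskiSite) : CommRingCat.of (S.sections U) ⟶ Γ(T, f ⁻¹ᵁ U.1) :=
  CommRingCat.ofHom (S.sections U).subtype

/-- The structure homomorphism of the sections. -/
def unit (U : X.AffineZariskiSite) : Γ(X, U.1) ⟶ CommRingCat.of (S.sections U) :=
  CommRingCat.ofHom ((f.app U.1).hom.codRestrict (S.sections U) (S.app_mem U))

lemma unit_incl (U : X.AffineZariskiSite) : S.unit U ≫ S.incl U = f.app U.1 := rfl

/-- The presheaf of sections. -/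
def diagram : X.AffineZariskiSiteᵒᵖ ⥤ CommRingCat where
  obj U := .of (S.sections U.unop)
  map {U V} i := CommRingCat.ofHom
    ((T.presheaf.map (homOfLE (f.preimage_mono (toOpens_mono i.unop.le))).op).hom.restrict
      (S.sections U.unop) (S.sections V.unop) fun t ht ↦ S.map_mem' i.unop t ht)
  map_id U := by
    ext x
    change T.presheaf.map (𝟙 _) x.1 = x.1
    simp
  map_comp i j := by
    ext x
    change T.presheaf.map _ x.1 = T.presheaf.map _ (T.presheaf.map _ x.1)
    rw [← CommRingCat.comp_apply, ← Functor.map_comp]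
    rfl

/-- The structure map of the presheaf of sections. -/
def diagramMap : (toOpensFunctor X).op ⋙ X.presheaf ⟶ S.diagram where
  app U := CommRingCat.ofHom ((f.app U.unop.1).hom.codRestrict (S.sections U.unop)
    (S.app_mem U.unop))
  naturality {U V} i := by
    ext x
    exact Subtype.ext congr($(f.naturality ((toOpensFunctor X).op.map i)) x)

/-- The restriction of sections. -/
def res {U V : X.AffineZariskiSite} (i : U ⟶ V) :
    CommRingCat.of (S.sections V) ⟶ CommRingCat.of (S.sections U) :=
  S.diagram.map i.op

lemma incl_naturality {U V : X.AffineZariskiSite} (i : U ⟶ V) :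
    S.incl V ≫ T.presheaf.map (homOfLE (f.preimage_mono (toOpens_mono i.le))).op =
      S.res i ≫ S.incl U := rfl

variable [QuasiCompact f] [QuasiSeparated f]

lemma isLocalization_away_app (U : X.AffineZariskiSite) (h : Γ(X, U.1)) :
    letI : Algebra Γ(T, f ⁻¹ᵁ U.1) Γ(T, f ⁻¹ᵁ X.basicOpen h) :=
      (T.presheaf.map (homOfLE (f.preimage_mono (X.basicOpen_le h))).op).hom.toAlgebra
    IsLocalization.Away (f.app U.1 h) Γ(T, f ⁻¹ᵁ X.basicOpen h) := by
  let inst : Algebra Γ(T, f ⁻¹ᵁ U.1) Γ(T, f ⁻¹ᵁ X.basicOpen h) :=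
      (T.presheaf.map (homOfLE (f.preimage_mono (X.basicOpen_le h))).op).hom.toAlgebra
  let : Algebra Γ(T, f ⁻¹ᵁ U.1) Γ(T, T.basicOpen (f.app _ h)) :=
      (T.presheaf.map (homOfLE (T.basicOpen_le _)).op).hom.toAlgebra
  dsimp +instances [inst]
  rw! (castMode := .all) [f.preimage_basicOpen h]
  exact isLocalization_basicOpen_of_qcqs (f.isCompact_preimage U.2.isCompact)
        (f.isQuasiSeparated_preimage U.2.isQuasiSeparated) (f.app _ h)

/-- The axioms `map_mem` and `exists_pow_mul_mem` together say that the sections over a basic open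
are the localization away from `h`. This is the condition under which the spectra glue to a scheme
affine over `X`. -/
lemma coequifibered_diagramMap : S.diagramMap.Coequifibered := by
  refine coequifibered_iff_forall_isLocalizationAway.mpr fun U h ↦ ?_
  have := isLocalization_away_app (f := f) U h
  set ρ := T.presheaf.map (homOfLE (f.preimage_mono (X.basicOpen_le h))).op with hρ
  let : Algebra Γ(T, f ⁻¹ᵁ U.1) Γ(T, f ⁻¹ᵁ X.basicOpen h) := ρ.hom.toAlgebra
  have hloc : IsLocalization.Away (f.app U.1 h) Γ(T, f ⁻¹ᵁ X.basicOpen h) :=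
    isLocalization_away_app U h
  have hρh : f.app (X.basicOpen h) (X.presheaf.map (homOfLE (X.basicOpen_le h)).op h) =
      ρ (f.app U.1 h) := congr($(f.naturality (homOfLE (X.basicOpen_le h)).op) h)
  have hu : IsUnit (X.presheaf.map (homOfLE (X.basicOpen_le h)).op h) :=
    RingedSpace.isUnit_res_basicOpen _ h
  have hinv : ρ (f.app U.1 h) * f.app (X.basicOpen h) (hu.unit⁻¹ : _) = 1 := by
    rw [← hρh, ← map_mul, hu.mul_val_inv, map_one]
  exact isLocalization_away_restrict ρ.hom _ _ (S.map_mem U h) _ (S.app_mem U h) hloc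
    ⟨_, S.app_mem (U.basicOpen h) _, hinv⟩ (S.exists_pow_mul_mem U h)

/-- The gluing datum of the relative spectrum. -/
def glueData : (directedCover X).RelativeGluingData :=
  relativeGluingData S.coequifibered_diagramMap

instance : (S.glueData.functor ⋙ Scheme.forget).IsLocallyDirected :=
  Scheme.Cover.RelativeGluingData.instIsLocallyDirectedI₀CompFunctorForgetOfIsThin ..

/-- The relative spectrum of a quasi-coherent subalgebra. -/
def glued : Scheme.{u} := S.glueData.glued

/-- The projection of the relative spectrum. -/
def toBase : S.glued ⟶ X := S.glueData.toBase

/-- The spectrum of the ring of sections over an affine open, as an open subscheme of the relative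
spectrum. -/
def ι (U : X.AffineZariskiSite) : Spec (.of (S.sections U)) ⟶ S.glued :=
  colimit.ι S.glueData.functor U

instance isOpenImmersion_ι (U : X.AffineZariskiSite) : IsOpenImmersion (S.ι U) :=
  S.glueData.cover.map_prop U

lemma map_ι {U V : X.AffineZariskiSite} (i : U ⟶ V) :
    Spec.map (S.res i) ≫ S.ι V = S.ι U :=
  colimit.w S.glueData.functor i

lemma ι_toBase (U : X.AffineZariskiSite) :
    S.ι U ≫ S.toBase = Spec.map (S.unit U) ≫ U.2.fromSpec := by
  refine (S.glueData.ι_toBase U).trans ?_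
  change (Spec.map _ ≫ U.2.isoSpec.inv) ≫ U.1.ι = _
  rw [Category.assoc, IsAffineOpen.isoSpec_inv_ι]
  rfl

lemma glued_hom_ext {Z : Scheme.{u}} (g h : S.glued ⟶ Z) (H : ∀ U, S.ι U ≫ g = S.ι U ≫ h) :
    g = h :=
  colimit.hom_ext (F := S.glueData.functor) H

/-- Morphisms from the relative spectrum are given by compatible families of morphisms. -/
def glueHom {Z : Scheme.{u}} (g : ∀ U, Spec (.of (S.sections U)) ⟶ Z)
    (H : ∀ (U V) (i : U ⟶ V), Spec.map (S.res i) ≫ g V = g U) : S.glued ⟶ Z :=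
  colimit.desc S.glueData.functor
    { pt := Z
      ι := { app := g, naturality := fun U V i ↦ (H U V i).trans (Category.comp_id _).symm } }

lemma ι_glueHom {Z : Scheme.{u}} (g : ∀ U, Spec (.of (S.sections U)) ⟶ Z)
    (H : ∀ (U V) (i : U ⟶ V), Spec.map (S.res i) ≫ g V = g U) (U) :
    S.ι U ≫ S.glueHom g H = g U :=
  colimit.ι_desc (F := S.glueData.functor) _ U

lemma toBase_preimage (U : X.AffineZariskiSite) : S.toBase ⁻¹ᵁ U.1 = (S.ι U).opensRange := by
  have h : ((directedCover X).f U).opensRange = U.1 := Scheme.Opens.opensRange_ι U.1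
  have := S.glueData.toBase_preimage_eq_opensRange_ι U
  rw [h] at this
  exact this

instance : IsAffineHom S.toBase := by
  refine isAffineHom_of_forall_exists_isAffineOpen _ fun x ↦ ?_
  obtain ⟨U, hxU⟩ := TopologicalSpace.Opens.mem_iSup.mp
    ((iSup_affineOpens_eq_top X).ge (Set.mem_univ x))
  refine ⟨U.1, hxU, U.2, ?_⟩
  have := S.isOpenImmersion_ι U
  have := isAffineOpen_opensRange (S.ι U)
  rwa [← S.toBase_preimage U] at this

/-- The canonical morphism to the relative spectrum, over an affine open. -/
def fromSourceAux (U : X.AffineZariskiSite) : (f ⁻¹ᵁ U.1).toScheme ⟶ S.glued :=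
  (f ⁻¹ᵁ U.1).toSpecΓ ≫ Spec.map (S.incl U) ≫ S.ι U

lemma homOfLE_fromSourceAux {U V : X.AffineZariskiSite} (i : U ⟶ V) :
    T.homOfLE (f.preimage_mono (toOpens_mono i.le)) ≫ S.fromSourceAux V = S.fromSourceAux U := by
  have h : T.homOfLE (f.preimage_mono (toOpens_mono i.le)) ≫ (f ⁻¹ᵁ V.1).toSpecΓ =
      (f ⁻¹ᵁ U.1).toSpecΓ ≫
        Spec.map (T.presheaf.map (homOfLE (f.preimage_mono (toOpens_mono i.le))).op) :=
    (Scheme.Opens.toSpecΓ_SpecMap_presheaf_map ..).symm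
  rw [fromSourceAux, ← Category.assoc, h, Category.assoc, ← Spec.map_comp_assoc,
    S.incl_naturality i, Spec.map_comp_assoc, S.map_ι, fromSourceAux]

lemma fromSource_compat {U V : X.AffineZariskiSite} (i : U ⟶ V)
    (t : pullback f U.1.ι ⟶ pullback f V.1.ι)
    (ht : t ≫ pullback.fst f V.1.ι = pullback.fst f U.1.ι) :
    t ≫ (pullbackRestrictIsoRestrict f V.1).hom ≫ S.fromSourceAux V =
      (pullbackRestrictIsoRestrict f U.1).hom ≫ S.fromSourceAux U := by
  rw [← Category.assoc, comp_pullbackRestrictIsoRestrict_hom f (toOpens_mono i.le) t ht,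
    Category.assoc, S.homOfLE_fromSourceAux i]

/-- The canonical morphism to the relative spectrum. -/
def fromSource : T ⟶ S.glued :=
  Scheme.OpenCover.glueMorphismsOfLocallyDirected ((directedCover X).pullback₁ f)
    (fun U : X.AffineZariskiSite ↦ (pullbackRestrictIsoRestrict f U.1).hom ≫ S.fromSourceAux U)
    fun i ↦ S.fromSource_compat i _ (Scheme.Cover.trans_map ((directedCover X).pullback₁ f) i)

lemma ι_fromSource (U : X.AffineZariskiSite) :
    (f ⁻¹ᵁ U.1).ι ≫ S.fromSource = S.fromSourceAux U := by
  rw [← cancel_epi (pullbackRestrictIsoRestrict f U.1).hom,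
    pullbackRestrictIsoRestrict_hom_ι_assoc]
  exact Scheme.OpenCover.map_glueMorphismsOfLocallyDirected ((directedCover X).pullback₁ f) _
    (fun i ↦ S.fromSource_compat i _
      (Scheme.Cover.trans_map ((directedCover X).pullback₁ f) i)) U

lemma fromSource_toBase : S.fromSource ≫ S.toBase = f := by
  refine Scheme.Cover.hom_ext (T.openCoverOfIsOpenCover _
    (.comap (iSup_affineOpens_eq_top X) f.base.1)) _ _ fun (U : X.AffineZariskiSite) ↦ ?_
  change (f ⁻¹ᵁ U.1).ι ≫ S.fromSource ≫ S.toBase = (f ⁻¹ᵁ U.1).ι ≫ f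
  rw [← Category.assoc, S.ι_fromSource, fromSourceAux, Category.assoc, Category.assoc,
    S.ι_toBase, ← Spec.map_comp_assoc]
  change (f ⁻¹ᵁ U.1).toSpecΓ ≫ Spec.map (f.app _) ≫ U.2.fromSpec = (f ⁻¹ᵁ U.1).ι ≫ _
  simp

lemma preimage_le_fromSource_preimage (U : X.Opens) :
    f ⁻¹ᵁ U ≤ S.fromSource ⁻¹ᵁ (S.toBase ⁻¹ᵁ U) := by
  rw [← Scheme.Hom.comp_preimage, S.fromSource_toBase]

lemma top_le_ι_preimage (U : X.AffineZariskiSite) : ⊤ ≤ S.ι U ⁻¹ᵁ S.toBase ⁻¹ᵁ U.1 := by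
  rw [S.toBase_preimage, Scheme.Hom.preimage_opensRange]

/-- The restriction of sections over the preimage of an affine open to the member of the cover. -/
def objHom (U : X.AffineZariskiSite) :
    Γ(S.glued, S.toBase ⁻¹ᵁ U.1) ⟶ .of (S.sections U) :=
  (S.ι U).appLE (S.toBase ⁻¹ᵁ U.1) ⊤ (S.top_le_ι_preimage U) ≫ (Scheme.ΓSpecIso _).hom

instance (U : X.AffineZariskiSite) : IsIso (S.objHom U) := by
  have : IsIso ((S.ι U).app (S.toBase ⁻¹ᵁ U.1)) :=
    (S.ι U).isIso_app _ (S.toBase_preimage U).le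
  have h : S.ι U ⁻¹ᵁ S.toBase ⁻¹ᵁ U.1 = ⊤ := top_le_iff.1 (S.top_le_ι_preimage U)
  have : IsIso ((S.ι U).appLE (S.toBase ⁻¹ᵁ U.1) ⊤ (S.top_le_ι_preimage U)) := by
    rw [Scheme.Hom.appLE]
    have : homOfLE (S.top_le_ι_preimage U) = eqToHom h.symm := rfl
    rw [this]
    infer_instance
  unfold objHom
  infer_instance

/-- The sections of the relative spectrum over an affine open. -/
def objIso (U : X.AffineZariskiSite) : Γ(S.glued, S.toBase ⁻¹ᵁ U.1) ≅ .of (S.sections U) :=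
  asIso (S.objHom U)

/-- This identifies the sections of the glued scheme, viewed inside those of `T`, with the given
subring, and so allows arguments about the relative spectrum to be carried out in `Γ(T, f ⁻¹ᵁ U)`.
-/
lemma fromSource_appLE (U : X.AffineZariskiSite) :
    S.fromSource.appLE (S.toBase ⁻¹ᵁ U.1) (f ⁻¹ᵁ U.1) (S.preimage_le_fromSource_preimage U.1) =
      (S.objIso U).hom ≫ S.incl U := by
  rw [appLE_of_ι_comp_eq (f ⁻¹ᵁ U.1) (S.incl U) (S.ι U) S.fromSource (S.ι_fromSource U) _
    (S.top_le_ι_preimage U)]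
  exact (Category.assoc _ _ _).symm

/-- The universal property of the relative spectrum. -/
def desc {Z : Scheme.{u}} (f₁ : T ⟶ Z) (f₂ : Z ⟶ X) [IsAffineHom f₂] (H : f = f₁ ≫ f₂)
    (h : ∀ (U : X.AffineZariskiSite) (z : Γ(Z, f₂ ⁻¹ᵁ U.1)),
      f₁.appLE (f₂ ⁻¹ᵁ U.1) (f ⁻¹ᵁ U.1) (by simp [H]) z ∈ S.sections U) : S.glued ⟶ Z :=
  S.glueHom (fun U ↦ Spec.map (CommRingCat.ofHom ((f₁.appLE (f₂ ⁻¹ᵁ U.1) (f ⁻¹ᵁ U.1)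
      (by simp [H])).hom.codRestrict (S.sections U) fun x ↦ h U x)) ≫ (U.2.preimage f₂).fromSpec)
    fun U V i ↦ by
      rw [← (V.2.preimage f₂).map_fromSpec (U.2.preimage f₂)
        (homOfLE (f₂.preimage_mono (toOpens_mono i.le))).op]
      refine (Spec.map_comp_assoc _ _ _).symm.trans
        (Eq.trans ?_ (Spec.map_comp_assoc _ _ _))
      refine congrArg (Spec.map · ≫ _) (CommRingCat.hom_ext (RingHom.ext fun z ↦ Subtype.ext ?_))
      change (f₁.appLE _ _ _ ≫ T.presheaf.map _) z = (Z.presheaf.map _ ≫ f₁.appLE _ _ _) z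
      rw [Scheme.Hom.appLE_map, Scheme.Hom.map_appLE]

lemma desc_comp {Z : Scheme.{u}} (f₁ : T ⟶ Z) (f₂ : Z ⟶ X) [IsAffineHom f₂] (H : f = f₁ ≫ f₂)
    (h : ∀ (U : X.AffineZariskiSite) (z : Γ(Z, f₂ ⁻¹ᵁ U.1)),
      f₁.appLE (f₂ ⁻¹ᵁ U.1) (f ⁻¹ᵁ U.1) (by simp [H]) z ∈ S.sections U) :
    S.desc f₁ f₂ H h ≫ f₂ = S.toBase := by
  refine S.glued_hom_ext _ _ fun U ↦ ?_
  rw [← Category.assoc, desc, S.ι_glueHom, Category.assoc,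
    ← IsAffineOpen.SpecMap_appLE_fromSpec _ U.2 _ le_rfl, S.ι_toBase]
  refine (Spec.map_comp_assoc _ _ _).symm.trans ?_
  refine congrArg (Spec.map · ≫ _) ?_
  refine CommRingCat.hom_ext (RingHom.ext fun z ↦ Subtype.ext ?_)
  change (f₂.appLE _ _ _ ≫ f₁.appLE _ _ _) z = f.app U.1 z
  rw [Scheme.Hom.appLE_comp_appLE, Scheme.Hom.app_eq_appLE]
  simp_rw [H]

lemma fromSource_appLE_injective (U : X.AffineZariskiSite) :
    Function.Injective (S.fromSource.appLE (S.toBase ⁻¹ᵁ U.1) (f ⁻¹ᵁ U.1)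
      (S.preimage_le_fromSource_preimage U.1)) := by
  rw [fromSource_appLE]
  exact Subtype.val_injective.comp (S.objIso U).commRingCatIsoToRingEquiv.injective

lemma range_fromSource_appLE (U : X.AffineZariskiSite) :
    (S.fromSource.appLE (S.toBase ⁻¹ᵁ U.1) (f ⁻¹ᵁ U.1)
      (S.preimage_le_fromSource_preimage U.1)).hom.range = S.sections U := by
  rw [fromSource_appLE]
  ext x
  constructor
  · rintro ⟨y, rfl⟩
    exact ((S.objIso U).hom y).2
  · intro hx
    obtain ⟨y, hy⟩ := (S.objIso U).commRingCatIsoToRingEquiv.surjective ⟨x, hx⟩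
    exact ⟨y, congr($(hy).1)⟩

end QCohSubalgebra

/-! ### Maps to fields -/

open TensorProduct in
-- The tensor product over a field of two nonzero algebras is nonzero, so it has a residue field.
lemma exists_field_amalgam {k L₁ L₂ : Type u} [Field k] [Field L₁] [Field L₂] (f₁ : k →+* L₁)
    (f₂ : k →+* L₂) : ∃ (L : Type u) (_ : Field L) (i₁ : L₁ →+* L) (i₂ : L₂ →+* L),
      i₁.comp f₁ = i₂.comp f₂ := by
  algebraize [f₁, f₂]
  obtain ⟨m, hm⟩ := Ideal.exists_maximal (L₁ ⊗[k] L₂)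
  let := Ideal.Quotient.field m
  refine ⟨_ ⧸ m, inferInstance, (Ideal.Quotient.mk m).comp Algebra.TensorProduct.includeLeftRingHom,
    (Ideal.Quotient.mk m).comp Algebra.TensorProduct.includeRight.toRingHom, ?_⟩
  rw [RingHom.comp_assoc, RingHom.comp_assoc]
  congr 1
  exact Algebra.TensorProduct.includeLeftRingHom_comp_algebraMap

/-- Lying over gives a prime of `C` above the kernel of `α`; its residue field is then amalgamated
with `K`. The field has to grow, since `C` need not have a `K`-valued point. -/
lemma exists_ringHom_extension {A C K : Type u} [CommRing A] [CommRing C] [Field K] (i : A →+* C)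
    (hi : i.IsIntegral) (hinj : Function.Injective i) (α : A →+* K) :
    ∃ (L : Type u) (_ : Field L) (ι : K →+* L) (α' : C →+* L), α'.comp i = ι.comp α := by
  let p : PrimeSpectrum A := ⟨RingHom.ker α, RingHom.ker_isPrime α⟩
  have := p.2
  obtain ⟨q, hq⟩ := hi.comap_surjective hinj p
  have hpq : p.asIdeal = q.asIdeal.comap i := congr($(hq.symm).asIdeal)
  let β : p.asIdeal.ResidueField →+* K := Ideal.ResidueField.lift p.asIdeal α le_rfl fun x hx ↦
    IsUnit.mk0 (α x) fun h ↦ hx h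
  obtain ⟨L, _, i₁, i₂, h⟩ := exists_field_amalgam β
    (Ideal.ResidueField.map p.asIdeal q.asIdeal i hpq)
  refine ⟨L, inferInstance, i₁, i₂.comp (algebraMap C q.asIdeal.ResidueField), ?_⟩
  ext x
  have := congr($h (algebraMap A _ x))
  simp only [RingHom.comp_apply, Ideal.ResidueField.map_algebraMap] at this ⊢
  exact this.symm.trans congr(i₁ $(Ideal.ResidueField.lift_algebraMap ..))

/-- A ring homomorphism is injective on points with values in fields. -/
def PointInjective {R S : Type u} [CommRing R] [CommRing S] (φ : R →+* S) : Prop :=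
  ∀ (K : Type u) [Field K] (α β : S →+* K), α.comp φ = β.comp φ → α = β

/-! ### The weak closure -/

section WeakClosure

variable (R Q : Type u) [CommRing R] [CommRing Q] [Algebra R Q]

/-- The elements integral over `R` that take the same value at any two field-valued points of the
integral closure that agree on `R`. -/
def weakClosure : Subalgebra R Q where
  carrier := {b | ∃ hb : b ∈ integralClosure R Q, ∀ (K : Type u) [Field K]
    (α β : integralClosure R Q →+* K), α.comp (algebraMap R _) = β.comp (algebraMap R _) →
      α ⟨b, hb⟩ = β ⟨b, hb⟩}
  mul_mem' := by
    rintro a b ⟨ha, ha'⟩ ⟨hb, hb'⟩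
    refine ⟨mul_mem ha hb, fun K _ α β h ↦ ?_⟩
    change α (⟨a, ha⟩ * ⟨b, hb⟩) = β (⟨a, ha⟩ * ⟨b, hb⟩)
    rw [map_mul, map_mul, ha' K α β h, hb' K α β h]
  add_mem' := by
    rintro a b ⟨ha, ha'⟩ ⟨hb, hb'⟩
    refine ⟨add_mem ha hb, fun K _ α β h ↦ ?_⟩
    change α (⟨a, ha⟩ + ⟨b, hb⟩) = β (⟨a, ha⟩ + ⟨b, hb⟩)
    rw [map_add, map_add, ha' K α β h, hb' K α β h]
  algebraMap_mem' r := ⟨(algebraMap R (integralClosure R Q) r).2, fun K _ α β h ↦ congr($h r)⟩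

variable {R Q}

lemma weakClosure_le : weakClosure R Q ≤ integralClosure R Q := fun _ h ↦ h.1

instance : Algebra.IsIntegral R (weakClosure R Q) :=
  ⟨fun x ↦ (isIntegral_algHom_iff (weakClosure R Q).val Subtype.val_injective).1
    (weakClosure_le x.2)⟩

/-- The definition tests elements on points of the integral closure, whereas here two points of the
smaller ring are given. Both extend to the integral closure after enlarging the field, and an
amalgam brings the extensions into one field, where they still agree on `R`. -/
lemma pointInjective_weakClosure : PointInjective (algebraMap R (weakClosure R Q)) := by
  intro K _ α β h
  let i : weakClosure R Q →+* integralClosure R Q :=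
    (Subalgebra.inclusion weakClosure_le).toRingHom
  have hinj : Function.Injective i := Subalgebra.inclusion_injective _
  have hi : i.IsIntegral := RingHom.IsIntegral.tower_top (algebraMap R (weakClosure R Q)) i
    (algebraMap_isIntegral_iff.2 (inferInstance : Algebra.IsIntegral R (integralClosure R Q)))
  obtain ⟨L₁, _, ι₁, α', hα⟩ := exists_ringHom_extension i hi hinj α
  obtain ⟨L₂, _, ι₂, β', hβ⟩ := exists_ringHom_extension i hi hinj β
  obtain ⟨L, _, j₁, j₂, hj⟩ := exists_field_amalgam ι₁ ι₂
  ext x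
  refine (j₁.comp ι₁).injective ?_
  have hα' (y) : j₁ (α' (i y)) = j₁ (ι₁ (α y)) := congr(j₁ ($hα y))
  have hβ' (y) : j₂ (β' (i y)) = j₁ (ι₁ (β y)) := (congr(j₂ ($hβ y))).trans congr($hj (β y)).symm
  refine (hα' x).symm.trans (Eq.trans ?_ (hβ' x))
  refine x.2.2 L (j₁.comp α') (j₂.comp β') ?_
  ext r
  exact (hα' (algebraMap R _ r)).trans (congr(j₁ (ι₁ ($h r))).trans
    (hβ' (algebraMap R _ r)).symm)

lemma weakClosure_eq_integralClosure_iff :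
    weakClosure R Q = integralClosure R Q ↔
      PointInjective (algebraMap R (integralClosure R Q)) := by
  constructor
  · rintro h K _ α β hαβ
    ext ⟨x, hx⟩
    exact (h.ge hx).2 K α β hαβ
  · exact fun h ↦ le_antisymm weakClosure_le fun x hx ↦ ⟨hx, fun K _ α β hαβ ↦ by rw [h K α β hαβ]⟩

/-- An integral `R`-algebra that is injective on points has image in the weak closure. -/
lemma mem_weakClosure_of_pointInjective {S : Type u} [CommRing S] (φ : R →+* S)
    (hφ : φ.IsIntegral) (hφ' : PointInjective φ) (ψ : S →+* Q)
    (hψ : ψ.comp φ = algebraMap R Q) (s : S) : ψ s ∈ weakClosure R Q := by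
  have hmem (s : S) : ψ s ∈ integralClosure R Q := by
    obtain ⟨p, hp, hps⟩ := hφ s
    refine ⟨p, hp, ?_⟩
    rw [← hψ, ← Polynomial.hom_eval₂, hps, map_zero]
  refine ⟨hmem s, fun K _ α β h ↦ ?_⟩
  let ψ' : S →+* integralClosure R Q := ψ.codRestrict _ hmem
  have : ψ'.comp φ = algebraMap R _ := by
    ext x
    exact congr($hψ x)
  refine congr($(hφ' K (α.comp ψ') (β.comp ψ') ?_) s)
  rw [RingHom.comp_assoc, this, RingHom.comp_assoc, this, h]

variable {R' Q' : Type u} [CommRing R'] [CommRing Q'] [Algebra R' Q'] [Algebra R R']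
  [Algebra Q Q'] [Algebra R Q'] [IsScalarTower R Q Q'] [IsScalarTower R R' Q']

lemma map_mem_integralClosure {b : Q} (hb : b ∈ integralClosure R Q) :
    algebraMap Q Q' b ∈ integralClosure R' Q' :=
  (hb.map (IsScalarTower.toAlgHom R Q Q')).tower_top

/-- Functoriality of the integral closure. -/
def integralClosureMap : integralClosure R Q →+* integralClosure R' Q' :=
  ((algebraMap Q Q').comp (integralClosure R Q).val.toRingHom).codRestrict
    (integralClosure R' Q') fun b ↦ map_mem_integralClosure (R := R) (b := (b : Q)) b.2

lemma integralClosureMap_comp : (integralClosureMap (R' := R') (Q' := Q')).comp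
    (algebraMap R (integralClosure R Q)) = (algebraMap R' _).comp (algebraMap R R') := by
  ext x
  change algebraMap Q Q' (algebraMap R Q x) = algebraMap R' Q' (algebraMap R R' x)
  rw [← IsScalarTower.algebraMap_apply, ← IsScalarTower.algebraMap_apply]

lemma map_mem_weakClosure {b : Q} (hb : b ∈ weakClosure R Q) :
    algebraMap Q Q' b ∈ weakClosure R' Q' := by
  obtain ⟨hb, h⟩ := hb
  refine ⟨map_mem_integralClosure hb, fun K _ α β hαβ ↦ ?_⟩
  refine h K (α.comp integralClosureMap) (β.comp integralClosureMap) ?_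
  rw [RingHom.comp_assoc, RingHom.comp_assoc, integralClosureMap_comp, ← RingHom.comp_assoc, hαβ,
    RingHom.comp_assoc]

lemma isLocalization_integralClosureMap (M : Submonoid R) [IsLocalization M R']
    [IsLocalization (Algebra.algebraMapSubmonoid Q M) Q'] :
    letI := (integralClosureMap (R := R) (Q := Q) (R' := R') (Q' := Q')).toAlgebra
    IsLocalization (Algebra.algebraMapSubmonoid (integralClosure R Q) M)
      (integralClosure R' Q') := by
  let := (integralClosureMap (R := R) (Q := Q) (R' := R') (Q' := Q')).toAlgebra
  have : IsScalarTower (integralClosure R Q) (integralClosure R' Q') Q' :=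
    .of_algebraMap_eq' rfl
  have : IsScalarTower R (integralClosure R Q) (integralClosure R' Q') :=
    .of_algebraMap_eq' (by
      rw [RingHom.algebraMap_toAlgebra, integralClosureMap_comp]
      ext x
      exact IsScalarTower.algebraMap_apply R R' Q' x)
  exact IsLocalization.integralClosure M

/-- The multiple must not separate points `α`, `β` of the integral closure agreeing on `R`. If they
do not kill `h`, they extend to the localization, where the hypothesis on `t` applies; if they kill
`h`, any multiple of `h` vanishes at both. -/
lemma exists_pow_mul_mem_weakClosure (h : R) [IsLocalization.Away h R']
    [IsLocalization.Away (algebraMap R Q h) Q'] (t : Q)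
    (ht : algebraMap Q Q' t ∈ weakClosure R' Q') :
    ∃ n : ℕ, algebraMap R Q h ^ n * t ∈ weakClosure R Q := by
  let := (integralClosureMap (R := R) (Q := Q) (R' := R') (Q' := Q')).toAlgebra
  have h1 : IsLocalization (Algebra.algebraMapSubmonoid Q (.powers h)) Q' := by
    rwa [Algebra.algebraMapSubmonoid_powers]
  have h2 := isLocalization_integralClosureMap (Q := Q) (R' := R') (Q' := Q') (.powers h)
  rw [Algebra.algebraMapSubmonoid_powers] at h2
  obtain ⟨ht, htα⟩ := ht
  obtain ⟨n, c, hc⟩ := IsLocalization.Away.surj (algebraMap R (integralClosure R Q) h)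
    (⟨_, ht⟩ : integralClosure R' Q')
  have hc' : algebraMap Q Q' (algebraMap R Q h ^ n * t) = algebraMap Q Q' c.1 := by
    rw [mul_comm, map_mul, map_pow]
    exact congr($(hc).1)
  obtain ⟨m, hm⟩ := IsLocalization.Away.exists_of_eq (algebraMap R Q h) hc'
  -- The exponent `m + n` already gives an integral element; the extra factor `h` makes it vanish at
  -- the points that kill `h`.
  refine ⟨m + n + 1, ?_⟩
  have key : algebraMap R Q h ^ (m + n + 1) * t =
      ((algebraMap R (integralClosure R Q) h ^ (m + 1) * c : integralClosure R Q) : Q) := by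
    push_cast
    change _ = algebraMap R Q h ^ (m + 1) * c
    linear_combination algebraMap R Q h * hm
  rw [key]
  refine ⟨Subtype.prop _, fun K _ α β hαβ ↦ ?_⟩
  change α (algebraMap R (integralClosure R Q) h ^ (m + 1) * c) =
    β (algebraMap R (integralClosure R Q) h ^ (m + 1) * c)
  have hh : α (algebraMap R _ h) = β (algebraMap R _ h) := congr($hαβ h)
  rw [map_mul, map_mul, map_pow, map_pow, hh]
  by_cases h0 : β (algebraMap R _ h) = 0
  · simp [h0]
  · congr 1
    have uα : IsUnit (α (algebraMap R _ h)) := (hh ▸ h0 : α (algebraMap R _ h) ≠ 0).isUnit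
    have uβ : IsUnit (β (algebraMap R _ h)) := IsUnit.mk0 _ h0
    let α' : integralClosure R' Q' →+* K := IsLocalization.Away.lift (algebraMap R _ h) uα
    let β' : integralClosure R' Q' →+* K := IsLocalization.Away.lift (algebraMap R _ h) uβ
    have hα' (x) : α' (integralClosureMap x) = α x := IsLocalization.Away.lift_eq _ uα x
    have hβ' (x) : β' (integralClosureMap x) = β x := IsLocalization.Away.lift_eq _ uβ x
    have : α' ⟨_, ht⟩ = β' ⟨_, ht⟩ := by
      refine htα K α' β' (IsLocalization.ringHom_ext (.powers h) ?_)
      rw [RingHom.comp_assoc, RingHom.comp_assoc, ← integralClosureMap_comp (Q := Q)]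
      ext x
      simp only [RingHom.comp_apply, hα', hβ']
      exact congr($hαβ x)
    rw [← hα', ← hβ']
    have e := congr(α' $hc)
    have e' := congr(β' $hc)
    rw [map_mul, map_pow] at e e'
    change _ * α' (integralClosureMap _) ^ n = α' (integralClosureMap c) at e
    change _ * β' (integralClosureMap _) ^ n = β' (integralClosureMap c) at e'
    rw [← e, ← e', this, hα', hβ', hh]

end WeakClosure

/-! ### Universally injective and universal homeomorphisms -/

lemma universallyInjective_SpecMap_iff {R S : CommRingCat.{u}} (φ : R ⟶ S) :
    UniversallyInjective (Spec.map φ) ↔ PointInjective φ.hom := by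
  rw [(tfae_universallyInjective (Spec.map φ)).out 0 1 rfl rfl]
  refine forall₂_congr fun K _ ↦ ⟨fun H α β h ↦ ?_, fun H a b h ↦ ?_⟩
  · have := H (a₁ := Spec.map (CommRingCat.ofHom α)) (a₂ := Spec.map (CommRingCat.ofHom β)) (by
      dsimp only
      rw [← Spec.map_comp, ← Spec.map_comp]
      exact congr(Spec.map (CommRingCat.ofHom $h)))
    exact congr(CommRingCat.Hom.hom $(Spec.map_injective this))
  · obtain ⟨α, rfl⟩ := Spec.map_surjective a
    obtain ⟨β, rfl⟩ := Spec.map_surjective b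
    dsimp only at h
    rw [← Spec.map_comp, ← Spec.map_comp] at h
    exact congr(Spec.map $(CommRingCat.hom_ext
      (H α.hom β.hom congr(CommRingCat.Hom.hom $(Spec.map_injective h)))))

lemma universallyInjective_iff_of_isAffineHom {Y X : Scheme.{u}} (p : Y ⟶ X) [IsAffineHom p] :
    UniversallyInjective p ↔ ∀ U : X.Opens, IsAffineOpen U → PointInjective (p.app U).hom := by
  have := UniversallyInjective.respectsIso.{u}
  rw [IsZariskiLocalAtTarget.iff_of_iSup_eq_top (P := @UniversallyInjective) _
    (iSup_affineOpens_eq_top X), Subtype.forall]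
  refine forall₂_congr fun U hU ↦ ?_
  change IsAffineOpen U at hU
  rw [← universallyInjective_SpecMap_iff,
    ← MorphismProperty.cancel_left_of_respectsIso @UniversallyInjective (hU.preimage p).isoSpec.hom,
    ← MorphismProperty.cancel_right_of_respectsIso @UniversallyInjective _ hU.isoSpec.hom]
  have : p ∣_ U ≫ hU.isoSpec.hom = (hU.preimage p).isoSpec.hom ≫ Spec.map (p.app U) := by
    rw [← cancel_mono hU.fromSpec]
    simp [IsAffineOpen.isoSpec_hom]
  rw [this]

/-- All three properties survive base change, and integral morphisms are closed. -/
lemma isUniversalHomeomorphism_of_isIntegralHom {Y X : Scheme.{u}} (p : Y ⟶ X) [IsIntegralHom p]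
    [UniversallyInjective p] [Surjective p] : IsUniversalHomeomorphism p := by
  intro Y' X' a b p' H
  have h1 : IsIntegralHom p' := MorphismProperty.of_isPullback H.flip ‹_›
  have h2 : UniversallyInjective p' := MorphismProperty.of_isPullback H.flip ‹_›
  have h3 : Surjective p' := MorphismProperty.of_isPullback H.flip ‹_›
  exact isHomeomorph_iff_continuous_isClosedMap_bijective.2
    ⟨p'.continuous, p'.isClosedMap, p'.injective, p'.surjective⟩

lemma IsUniversalHomeomorphism.universallyInjective {Y X : Scheme.{u}} {p : Y ⟶ X}
    (h : IsUniversalHomeomorphism p) : UniversallyInjective p :=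
  ⟨fun _ _ _ _ _ H ↦ (h _ _ _ H).injective⟩

lemma IsUniversalHomeomorphism.isHomeomorph {Y X : Scheme.{u}} {p : Y ⟶ X}
    (h : IsUniversalHomeomorphism p) : IsHomeomorph p :=
  h _ _ _ (IsPullback.of_id_snd)

/-! ### The scheme of generic points -/

section GenericScheme

variable (X : Scheme.{u})

/-- The inclusion of a generic point. -/
def genericι (η : genericPoints X) : Spec (X.residueField η.1) ⟶ genericScheme X :=
  Sigma.ι (fun η : genericPoints X ↦ Spec (X.residueField η.1)) η

@[simp]
lemma genericι_genericSchemeMap (η : genericPoints X) :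
    genericι X η ≫ genericSchemeMap X = X.fromSpecResidueField η.1 :=
  Sigma.ι_desc _ _

lemma genericι_hom_ext {Y : Scheme.{u}} {a b : genericScheme X ⟶ Y}
    (h : ∀ η, genericι X η ≫ a = genericι X η ≫ b) : a = b :=
  Sigma.hom_ext _ _ h

/-- The cover of the scheme of generic points. -/
def genericCover : (genericScheme X).OpenCover :=
  sigmaOpenCover fun η : genericPoints X ↦ Spec (X.residueField η.1)

instance : IsReduced (genericScheme X) :=
  have (η : (genericCover X).I₀) : IsReduced ((genericCover X).X η) :=
    let η' : genericPoints X := η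
    inferInstanceAs (IsReduced (Spec (X.residueField η'.1)))
  IsReduced.of_openCover _ (genericCover X)

instance : SurjectiveOnStalks (genericSchemeMap X) :=
  (IsZariskiLocalAtSource.iff_of_openCover (P := @SurjectiveOnStalks) (genericCover X)).2 <| by
      intro (η : genericPoints X)
      change SurjectiveOnStalks (genericι X η ≫ genericSchemeMap X)
      rw [genericι_genericSchemeMap]
      exact (inferInstance : IsPreimmersion _).toSurjectiveOnStalks

variable {X}

lemma exists_genericSchemeMap_eq {η : X} (hη : η ∈ genericPoints X) :
    ∃ t : genericScheme X, genericSchemeMap X t = η := by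
  let y : Spec (X.residueField η) := IsLocalRing.closedPoint (X.residueField η)
  refine ⟨genericι X ⟨η, hη⟩ y, ?_⟩
  rw [← Scheme.Hom.comp_apply, genericι_genericSchemeMap, X.fromSpecResidueField_apply]

lemma exists_genericι_eq (t : genericScheme X) : ∃ (η : genericPoints X)
    (y : Spec (X.residueField η.1)), genericSchemeMap X t = η.1 ∧ genericι X η y = t := by
  obtain ⟨(η : genericPoints X), (y : Spec (X.residueField η.1)), rfl⟩ :=
    (genericCover X).exists_eq t
  refine ⟨η, y, ?_, rfl⟩
  change genericSchemeMap X (genericι X η y) = _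
  rw [← Scheme.Hom.comp_apply, genericι_genericSchemeMap, X.fromSpecResidueField_apply]

lemma genericSchemeMap_mem (t : genericScheme X) : genericSchemeMap X t ∈ genericPoints X := by
  obtain ⟨η, y, h, -⟩ := exists_genericι_eq t
  exact h ▸ η.2

lemma genericSchemeMap_injective : Function.Injective (genericSchemeMap X) := by
  intro s t h
  obtain ⟨η, y, hη, rfl⟩ := exists_genericι_eq s
  obtain ⟨ζ, z, hζ, rfl⟩ := exists_genericι_eq t
  obtain rfl : η = ζ := Subtype.ext (hη.symm.trans (h.trans hζ))
  congr 1
  exact Subsingleton.elim (α := PrimeSpectrum (X.residueField η.1)) _ _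

lemma residueFieldMap_bijective_of_surjectiveOnStalks {Y X : Scheme.{u}} (f : Y ⟶ X)
    [SurjectiveOnStalks f] (y : Y) : Function.Bijective (f.residueFieldMap y) := by
  refine ⟨RingHom.injective _, fun z ↦ ?_⟩
  obtain ⟨a, rfl⟩ := Y.residue_surjective y z
  obtain ⟨b, rfl⟩ := f.stalkMap_surjective y a
  exact ⟨X.residue _ b, congr($(Scheme.residue_residueFieldMap f y) b)⟩

lemma genericPoints_eq_of_specializes {X : Type*} [TopologicalSpace X] [T0Space X] {x y : X}
    (hx : x ∈ genericPoints X) (hy : y ∈ genericPoints X) (h : x ⤳ y) : x = y := by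
  have h1 : closure {y} ⊆ closure {x} := h.closure_subset
  have h2 : closure {y} = closure {x} := h1.antisymm (hy.2 hx.1 h1)
  exact (IsGenericPoint.eq h2 rfl).symm

lemma range_genericSchemeMap : Set.range (genericSchemeMap X) = genericPoints X :=
  Set.Subset.antisymm (Set.range_subset_iff.2 genericSchemeMap_mem)
    fun _ h ↦ exists_genericSchemeMap_eq h

instance : IsDominant (genericSchemeMap X) :=
  ⟨by rw [DenseRange, range_genericSchemeMap, dense_iff_closure_eq, genericPoints.closure]⟩

lemma ext_evaluation {T : Scheme.{u}} [IsReduced T] {V : T.Opens} {a b : Γ(T, V)}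
    (h : ∀ t (ht : t ∈ V), T.evaluation V t ht a = T.evaluation V t ht b) : a = b := by
  rw [← sub_eq_zero]
  refine (basicOpen_eq_bot_iff _).1
    ((Scheme.basicOpen_eq_bot_iff_forall_evaluation_eq_zero _ _).2 fun t ↦ ?_)
  rw [map_sub, h, sub_self]

lemma isUnit_of_evaluation_ne_zero {T : Scheme.{u}} {V : T.Opens} {a : Γ(T, V)}
    (h : ∀ t (ht : t ∈ V), T.evaluation V t ht a ≠ 0) : IsUnit a := by
  refine RingedSpace.isUnit_of_isUnit_germ _ V a fun t ht ↦ ?_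
  exact (RingedSpace.mem_basicOpen _ a t ht).1
    ((T.evaluation_ne_zero_iff_mem_basicOpen t ht a).1 (h t ht))

/-- A nonempty basic open of `r` would meet the dense image of `T`, where `r` vanishes. -/
lemma isNilpotent_of_app_eq_zero {T : Scheme.{u}} (f : T ⟶ X) [IsDominant f] {U : X.Opens}
    (hU : IsAffineOpen U) (r : Γ(X, U)) (hr : f.app U r = 0) : IsNilpotent r := by
  rw [Scheme.isNilpotent_iff_basicOpen_eq_bot_of_isCompact hU.isCompact]
  by_contra h
  have : f ⁻¹ᵁ X.basicOpen r = ⊥ := by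
    rw [Scheme.preimage_basicOpen, hr, Scheme.basicOpen_zero]
  obtain ⟨t, ht⟩ := f.denseRange.exists_mem_open (X.basicOpen r).2
    ((TopologicalSpace.Opens.ne_bot_iff_nonempty _).1 h)
  exact this.le ht

/-- Every element of `κ(x)` is a fraction of sections over an affine open. -/
lemma exists_evaluation_mul_eq {U : X.Opens} (hU : IsAffineOpen U) {x : X} (hx : x ∈ U)
    (z : X.residueField x) : ∃ a s : Γ(X, U), X.evaluation U x hx s ≠ 0 ∧
      X.evaluation U x hx s * z = X.evaluation U x hx a := by
  obtain ⟨y, rfl⟩ := X.residue_surjective x z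
  let : Algebra Γ(X, U) (X.presheaf.stalk x) := X.presheaf.algebra_section_stalk ⟨x, hx⟩
  have : IsLocalization.AtPrime (X.presheaf.stalk x) (hU.primeIdealOf ⟨x, hx⟩).asIdeal :=
    hU.isLocalization_stalk ⟨x, hx⟩
  obtain ⟨⟨a, s⟩, h⟩ := IsLocalization.surj (hU.primeIdealOf ⟨x, hx⟩).asIdeal.primeCompl y
  have hs := IsLocalization.map_units (X.presheaf.stalk x) s
  refine ⟨a, s, ?_, ?_⟩
  · exact (hs.map (X.residue x).hom).ne_zero
  · rw [mul_comm]
    exact ((map_mul _ _ _).symm.trans congr(X.residue x $h))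

lemma exists_evaluation_ne_zero {U : X.Opens} (hU : IsAffineOpen U) {x y : X} (hx : x ∈ U)
    (hy : y ∈ U) (h : ¬ y ⤳ x) : ∃ a : Γ(X, U),
      X.evaluation U x hx a ≠ 0 ∧ X.evaluation U y hy a = 0 := by
  rw [specializes_iff_forall_open] at h
  push Not at h
  obtain ⟨V, hV, hxV, hyV⟩ := h
  obtain ⟨a, haV, hxa⟩ := hU.exists_basicOpen_le (V := ⟨V, hV⟩) ⟨x, hxV⟩ hx
  refine ⟨a, (X.evaluation_ne_zero_iff_mem_basicOpen x hx a).2 hxa, ?_⟩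
  by_contra h
  exact hyV (haV ((X.evaluation_ne_zero_iff_mem_basicOpen y hy a).1 h))

lemma evaluation_genericSchemeMap_app {U : X.Opens} (t : genericScheme X)
    (ht : genericSchemeMap X t ∈ U) (a : Γ(X, U)) :
    (genericScheme X).evaluation (genericSchemeMap X ⁻¹ᵁ U) t ht ((genericSchemeMap X).app U a) =
      (genericSchemeMap X).residueFieldMap t (X.evaluation U (genericSchemeMap X t) ht a) :=
  congr($(Scheme.evaluation_naturality (genericSchemeMap X) t ht) a).symm

section Noetherian

variable [IsNoetherian X]

instance : Finite (genericScheme X) :=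
  have := finite_genericPoints X
  Finite.of_injective (fun t ↦ (⟨_, genericSchemeMap_mem t⟩ : genericPoints X))
    fun _ _ h ↦ genericSchemeMap_injective congr($(h).1)

/-- Distinct generic points do not specialize to each other, so for each `t'` some function vanishes
there but not at `t`. The product over the finitely many `t'` serves all of them at once. -/
lemma exists_evaluation_eq_zero_of_ne {U : X.Opens} (hU : IsAffineOpen U) (t : genericScheme X) :
    ∃ e : Γ(X, U), (∀ ht : genericSchemeMap X t ∈ U,
        X.evaluation U (genericSchemeMap X t) ht e ≠ 0) ∧
      ∀ t' (ht' : genericSchemeMap X t' ∈ U), t' ≠ t →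
        X.evaluation U (genericSchemeMap X t') ht' e = 0 := by
  classical
  by_cases ht : genericSchemeMap X t ∈ U
  swap
  · exact ⟨0, fun h ↦ (ht h).elim, fun _ _ _ ↦ map_zero _⟩
  have H (t' : genericScheme X) : ∃ e : Γ(X, U), X.evaluation U (genericSchemeMap X t) ht e ≠ 0 ∧
      ∀ ht' : genericSchemeMap X t' ∈ U, t' ≠ t →
        X.evaluation U (genericSchemeMap X t') ht' e = 0 := by
    by_cases h : genericSchemeMap X t' ∈ U ∧ t' ≠ t
    · obtain ⟨a, ha, ha'⟩ := exists_evaluation_ne_zero hU ht h.1 fun hs ↦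
        h.2 (genericSchemeMap_injective (genericPoints_eq_of_specializes
          (genericSchemeMap_mem t') (genericSchemeMap_mem t) hs))
      exact ⟨a, ha, fun _ _ ↦ ha'⟩
    · exact ⟨1, by simp, fun h1 h2 ↦ (h ⟨h1, h2⟩).elim⟩
  choose e he he' using H
  have := Fintype.ofFinite (genericScheme X)
  refine ⟨∏ t', e t', fun _ ↦ ?_, fun t' ht' hne ↦ ?_⟩
  · rw [map_prod]
    exact Finset.prod_ne_zero_iff.2 fun t' _ ↦ he t'
  · rw [map_prod]
    exact Finset.prod_eq_zero (Finset.mem_univ t') (he' t' ht' hne)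

/-- The ring of sections of the scheme of generic points over an affine open is the product of
the residue fields, and all its elements are fractions. -/
lemma exists_evaluation_genericSchemeMap_mul_eq {U : X.Opens} (hU : IsAffineOpen U)
    (z : ∀ t : genericScheme X, (genericScheme X).residueField t) :
    ∃ a s : Γ(X, U), IsUnit ((genericSchemeMap X).app U s) ∧
      ∀ t (ht : t ∈ genericSchemeMap X ⁻¹ᵁ U),
        (genericScheme X).evaluation _ t ht ((genericSchemeMap X).app U s) * z t =
        (genericScheme X).evaluation _ t ht ((genericSchemeMap X).app U a) := by
  classical
  have := Fintype.ofFinite (genericScheme X)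
  choose e he he' using exists_evaluation_eq_zero_of_ne (X := X) hU
  have H (t : genericScheme X) : ∃ a s : Γ(X, U), ∀ ht : t ∈ genericSchemeMap X ⁻¹ᵁ U,
      X.evaluation U (genericSchemeMap X t) ht s ≠ 0 ∧
      (genericScheme X).evaluation _ t ht ((genericSchemeMap X).app U s) * z t =
        (genericScheme X).evaluation _ t ht ((genericSchemeMap X).app U a) := by
    by_cases ht : t ∈ genericSchemeMap X ⁻¹ᵁ U
    · obtain ⟨y, hy⟩ :=
        (residueFieldMap_bijective_of_surjectiveOnStalks (genericSchemeMap X) t).2 (z t)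
      obtain ⟨a, s, hs, h⟩ := exists_evaluation_mul_eq hU (x := genericSchemeMap X t) ht y
      refine ⟨a, s, fun _ ↦ ⟨hs, ?_⟩⟩
      rw [evaluation_genericSchemeMap_app t ht, evaluation_genericSchemeMap_app t ht, ← hy, ← h]
      exact (map_mul _ _ _).symm
    · exact ⟨0, 0, fun h ↦ (ht h).elim⟩
  choose a s h using H
  have key (b : genericScheme X → Γ(X, U)) (t) (ht : t ∈ genericSchemeMap X ⁻¹ᵁ U) :
      X.evaluation U (genericSchemeMap X t) ht (∑ t', e t' * b t') =
      X.evaluation U (genericSchemeMap X t) ht (e t * b t) := by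
    rw [map_sum]
    refine Finset.sum_eq_single t (fun t' _ hne ↦ ?_) (fun h ↦ (h (Finset.mem_univ t)).elim)
    rw [map_mul, he' t' t ht hne.symm, zero_mul]
  -- Interpolation: at `t` only the summand with index `t` survives in both sums, and its factor `e
  -- t` is common to numerator and denominator.
  refine ⟨∑ t, e t * a t, ∑ t, e t * s t, ?_, fun t ht ↦ ?_⟩
  · refine isUnit_of_evaluation_ne_zero fun t ht ↦ ?_
    rw [evaluation_genericSchemeMap_app t ht, key, map_mul]
    exact (map_ne_zero _).2 (mul_ne_zero (he t ht) (h t ht).1)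
  · rw [evaluation_genericSchemeMap_app t ht, evaluation_genericSchemeMap_app t ht, key, key,
      map_mul, map_mul, map_mul, map_mul, mul_assoc, ← evaluation_genericSchemeMap_app t ht,
      ← evaluation_genericSchemeMap_app t ht (s t), (h t ht).2,
      evaluation_genericSchemeMap_app t ht, evaluation_genericSchemeMap_app t ht]

lemma exists_section_evaluation_eq {U : X.Opens} (hU : IsAffineOpen U)
    (z : ∀ t : genericScheme X, (genericScheme X).residueField t) :
    ∃ q : Γ(genericScheme X, genericSchemeMap X ⁻¹ᵁ U), ∀ t ht,
        (genericScheme X).evaluation _ t ht q = z t := by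
  obtain ⟨a, s, ⟨u, hu⟩, h⟩ := exists_evaluation_genericSchemeMap_mul_eq hU z
  refine ⟨(genericSchemeMap X).app U a * (u⁻¹ : _), fun t ht ↦ ?_⟩
  have h1 := h t ht
  rw [← hu] at h1
  rw [map_mul, ← h1, mul_comm, ← mul_assoc, ← map_mul, u.inv_mul, map_one, one_mul]

lemma exists_genericSchemeMap_app_mul_eq {U : X.Opens} (hU : IsAffineOpen U)
    (q : Γ(genericScheme X, genericSchemeMap X ⁻¹ᵁ U)) :
    ∃ a s : Γ(X, U), IsUnit ((genericSchemeMap X).app U s) ∧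
      (genericSchemeMap X).app U s * q = (genericSchemeMap X).app U a := by
  classical
  obtain ⟨a, s, hs, h⟩ := exists_evaluation_genericSchemeMap_mul_eq hU
    (fun t ↦ if ht : t ∈ genericSchemeMap X ⁻¹ᵁ U then
      (genericScheme X).evaluation _ t ht q else 0)
  refine ⟨a, s, hs, ext_evaluation fun t ht ↦ ?_⟩
  rw [map_mul, ← h t ht, dif_pos ht]

/-- In a product of fields, let `b` be the componentwise inverse of `a`, with `0⁻¹ = 0`; then `e = a
* b` is the indicator of the support of `a`. The commutative algebra below uses the product
structure of `Q` only in this form. -/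
lemma exists_idempotent_support {U : X.Opens} (hU : IsAffineOpen U)
    (a : Γ(genericScheme X, genericSchemeMap X ⁻¹ᵁ U)) :
    ∃ e b : Γ(genericScheme X, genericSchemeMap X ⁻¹ᵁ U), e * e = e ∧ e * a = a ∧ a * b = e := by
  classical
  obtain ⟨b, hb⟩ := exists_section_evaluation_eq hU
    (fun t ↦ if ht : t ∈ genericSchemeMap X ⁻¹ᵁ U then
      ((genericScheme X).evaluation _ t ht a)⁻¹ else 0)
  have key : a * b * a = a := ext_evaluation fun t ht ↦ by
    rw [map_mul, map_mul, hb t ht, dif_pos ht]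
    exact mul_inv_mul_cancel _
  exact ⟨a * b, b, by rw [← mul_assoc, key], key, rfl⟩

end Noetherian

end GenericScheme

/-! ### Integral closedness of the local rings of an integral closure -/

section IntegralClosure

variable {R S Q : Type u} [CommRing R] [CommRing S] [CommRing Q] [Algebra R S] [Algebra S Q]
  [Algebra R Q] [IsScalarTower R S Q]

/-- If `w * a * b = 0`, the support idempotent `ε` of `w * a` fixes `w * a` and kills `b`. One of
`ε`, `1 - ε` lies outside `q`, so `b` or `a` becomes zero in the localization. -/
lemma isDomain_localization_of_idempotents (hinj : Function.Injective (algebraMap S Q))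
    (hidem : ∀ e : Q, e * e = e → ∃ ε : S, algebraMap S Q ε = e)
    (hsupp : ∀ a : Q, ∃ e b : Q, e * e = e ∧ e * a = a ∧ a * b = e)
    (q : Ideal S) [q.IsPrime] : IsDomain (Localization.AtPrime q) := by
  have : NoZeroDivisors (Localization.AtPrime q) := by
    refine ⟨fun {x y} hxy ↦ ?_⟩
    obtain ⟨⟨a, u⟩, rfl⟩ := IsLocalization.mk'_surjective q.primeCompl x
    obtain ⟨⟨b, v⟩, rfl⟩ := IsLocalization.mk'_surjective q.primeCompl y
    rw [← IsLocalization.mk'_mul, IsLocalization.mk'_eq_zero_iff] at hxy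
    obtain ⟨w, hw⟩ := hxy
    obtain ⟨e, c, he, hea, hac⟩ := hsupp (algebraMap S Q (w * a))
    obtain ⟨ε, rfl⟩ := hidem e he
    have h1 : ε * (w * a) = w * a := hinj (by rw [map_mul, hea])
    have h2 : ε * b = 0 := hinj (by
      rw [map_mul, ← hac, mul_right_comm, ← map_mul, mul_assoc, hw, map_zero, zero_mul])
    by_cases hε : ε ∈ q
    · left
      rw [IsLocalization.mk'_eq_zero_iff]
      refine ⟨⟨(1 - ε) * w, q.primeCompl.mul_mem ?_ w.2⟩, ?_⟩
      · exact fun h ↦ Ideal.IsPrime.one_notMem ‹_› (by simpa using add_mem h hε)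
      · change (1 - ε) * w * a = 0
        linear_combination -h1
    · right
      rw [IsLocalization.mk'_eq_zero_iff]
      exact ⟨⟨ε, hε⟩, h2⟩
  exact NoZeroDivisors.to_isDomain _

/-- Localizing `Q` at `S ∖ q` gives the fraction field of the domain `S_q`. Since `S` is integrally
closed in `Q` and integral closure commutes with localization, `S_q` is integrally closed in that
field. -/
lemma isIntegrallyClosed_localization_of_idempotents (hinj : Function.Injective (algebraMap S Q))
    (hint : ∀ x : Q, IsIntegral S x → ∃ y : S, algebraMap S Q y = x)
    (hsupp : ∀ a : Q, ∃ e b : Q, e * e = e ∧ e * a = a ∧ a * b = e)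
    (hfrac : ∀ x : Q, ∃ a s : S, IsUnit (algebraMap S Q s) ∧
      algebraMap S Q s * x = algebraMap S Q a)
    (q : Ideal S) [q.IsPrime] :
    IsDomain (Localization.AtPrime q) ∧ IsIntegrallyClosed (Localization.AtPrime q) := by
  have hidem (e : Q) (he : e * e = e) : ∃ ε : S, algebraMap S Q ε = e :=
    hint e ⟨.X ^ 2 - .X, by monicity!, by simp [pow_two, he]⟩
  have := isDomain_localization_of_idempotents hinj hidem hsupp q
  refine ⟨this, ?_⟩
  let D := Localization.AtPrime q
  let K := Localization (Algebra.algebraMapSubmonoid Q q.primeCompl)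
  have hle : q.primeCompl ≤
      (Algebra.algebraMapSubmonoid Q q.primeCompl).comap (algebraMap S Q) :=
    Submonoid.le_comap_map q.primeCompl
  let : Algebra D K := (IsLocalization.map K (algebraMap S Q) hle : D →+* K).toAlgebra
  have hDK (s : S) : algebraMap D K (algebraMap S D s) = algebraMap Q K (algebraMap S Q s) :=
    IsLocalization.map_eq hle s
  have : IsScalarTower S D K := .of_algebraMap_eq fun s ↦ by
    rw [hDK, ← IsScalarTower.algebraMap_apply]
  have hDKinj (a : S) (h : algebraMap D K (algebraMap S D a) = 0) : algebraMap S D a = 0 := by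
    rw [hDK, IsLocalization.map_eq_zero_iff (Algebra.algebraMapSubmonoid Q q.primeCompl)] at h
    obtain ⟨⟨_, w, hw, rfl⟩, h⟩ := h
    rw [IsLocalization.map_eq_zero_iff q.primeCompl]
    exact ⟨⟨w, hw⟩, hinj (by simpa using h)⟩
  -- The support idempotent of `a` fixes a nonzero element of the domain `D`, so it becomes `1`
  -- there, and `c` becomes an inverse of `a`.
  have hunit (a : S) (ha : algebraMap S D a ≠ 0) : IsUnit (algebraMap D K (algebraMap S D a)) := by
    obtain ⟨e, c, he, hea, hac⟩ := hsupp (algebraMap S Q a)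
    obtain ⟨ε, rfl⟩ := hidem e he
    have h1 : ε * a = a := hinj (by rw [map_mul, hea])
    have h2 : algebraMap S D ε = 1 := by
      refine mul_right_cancel₀ ha ?_
      rw [← map_mul, h1, one_mul]
    refine IsUnit.of_mul_eq_one (algebraMap Q K c) ?_
    rw [hDK, ← map_mul, hac, ← hDK, h2, map_one]
  have : IsFractionRing D K := by
    refine ⟨⟨?_, ?_, ?_⟩⟩
    · rintro ⟨d, hd⟩
      obtain ⟨⟨a, u⟩, rfl⟩ := IsLocalization.mk'_surjective q.primeCompl d
      have ha : algebraMap S D a ≠ 0 := fun h ↦ nonZeroDivisors.ne_zero hd (by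
        rw [IsLocalization.mk'_eq_zero_iff, ← IsLocalization.map_eq_zero_iff q.primeCompl D, h])
      have := hunit a ha
      rw [← IsLocalization.mk'_spec D a u, map_mul] at this
      exact isUnit_of_mul_isUnit_left this
    · intro z
      obtain ⟨⟨x, _, s, hs, rfl⟩, rfl⟩ :=
        IsLocalization.mk'_surjective (Algebra.algebraMapSubmonoid Q q.primeCompl) z
      obtain ⟨a, t, ht, hta⟩ := hfrac x
      have hst : algebraMap S D (s * t) ≠ 0 := by
        rw [Ne, IsLocalization.map_eq_zero_iff q.primeCompl]
        rintro ⟨w, hw⟩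
        have : algebraMap S Q (w * s) = 0 := by
          rw [← ht.mul_left_eq_zero, ← map_mul, mul_assoc, hw, map_zero]
        exact (w * ⟨s, hs⟩ : q.primeCompl).2
          (by rw [show ((w * ⟨s, hs⟩ : q.primeCompl) : S) = 0 from hinj (by simpa using this)]
              exact zero_mem _)
      refine ⟨⟨algebraMap S D a, algebraMap S D (s * t), mem_nonZeroDivisors_of_ne_zero hst⟩, ?_⟩
      change _ * algebraMap D K (algebraMap S D (s * t)) = algebraMap D K (algebraMap S D a)
      rw [hDK, hDK, map_mul, map_mul, ← mul_assoc, ← hta, map_mul, mul_comm (algebraMap Q K _)]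
      congr 1
      exact IsLocalization.mk'_spec K x (⟨_, s, hs, rfl⟩ : Algebra.algebraMapSubmonoid Q _)
    · intro x y hxy
      refine ⟨1, ?_⟩
      rw [← sub_eq_zero, ← map_sub] at hxy
      obtain ⟨⟨a, u⟩, h⟩ := IsLocalization.mk'_surjective q.primeCompl (x - y)
      rw [← h] at hxy
      have h1 := hDKinj a (by
        rw [← IsLocalization.mk'_spec D a u, map_mul, hxy, zero_mul])
      have : x - y = 0 := by
        rw [← h, IsLocalization.mk'_eq_zero_iff, ← IsLocalization.map_eq_zero_iff q.primeCompl D,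
          h1]
      rw [sub_eq_zero.1 this]
  rw [isIntegrallyClosed_iff K]
  intro x hx
  obtain ⟨⟨y, _, s, hs, rfl⟩, rfl⟩ :=
    IsLocalization.mk'_surjective (Algebra.algebraMapSubmonoid Q q.primeCompl) x
  -- Denominators are cleared twice: `m` makes the element integral over `S` instead of `D`, and
  -- `m'` below makes a representative in `Q` itself integral over `S`. The latter lies in `S` by
  -- `hint`.
  obtain ⟨m, hm⟩ := hx.exists_multiple_integral_of_isLocalization q.primeCompl
  have h1 : IsIntegral S (algebraMap Q K (algebraMap S Q m * y)) := by
    have := (hm.smul s)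
    refine (congrArg (IsIntegral S) ?_).mp this
    dsimp only
    rw [Submonoid.smul_def, Algebra.smul_def, Algebra.smul_def, map_mul,
      ← IsLocalization.mk'_spec K y (⟨_, s, hs, rfl⟩ : Algebra.algebraMapSubmonoid Q _),
      IsScalarTower.algebraMap_apply S Q K, IsScalarTower.algebraMap_apply S Q K]
    ring
  obtain ⟨m', hm', h2⟩ := IsLocalization.exists_isIntegral_smul_of_isIntegral_map
    (Sₘ := K) q.primeCompl h1
  obtain ⟨z, hz⟩ := hint _ h2
  refine ⟨IsLocalization.mk' D z (⟨m', hm'⟩ * m * ⟨s, hs⟩), ?_⟩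
  have hu : IsUnit (algebraMap S K ((⟨m', hm'⟩ * m * ⟨s, hs⟩ : q.primeCompl) : S)) := by
    rw [IsScalarTower.algebraMap_apply S D K]
    exact (IsLocalization.map_units D _).map _
  refine hu.mul_right_cancel ?_
  rw [IsScalarTower.algebraMap_apply S D K, ← map_mul, IsLocalization.mk'_spec, hDK, hz,
    ← IsScalarTower.algebraMap_apply]
  have := IsLocalization.mk'_spec K y (⟨_, s, hs, rfl⟩ : Algebra.algebraMapSubmonoid Q _)
  rw [Algebra.smul_def, map_mul, map_mul, ← this]
  simp only [Submonoid.coe_mul, map_mul, ← IsScalarTower.algebraMap_apply S Q K]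
  ring

/-- An integral element over `R` lies in `S` if the local rings of `S` are integrally closed
domains. -/
lemma exists_algebraMap_eq_of_isIntegrallyClosed_localization
    (hinj : Function.Injective (algebraMap S Q))
    (h : ∀ (q : Ideal S) [q.IsPrime], IsDomain (Localization.AtPrime q) ∧
      IsIntegrallyClosed (Localization.AtPrime q))
    (hfrac : ∀ x : Q, ∃ a s : R, IsUnit (algebraMap R Q s) ∧
      algebraMap R Q s * x = algebraMap R Q a)
    (x : Q) (hx : IsIntegral R x) : ∃ y : S, algebraMap S Q y = x := by
  -- `I` is the ideal of denominators of `x`. If it were contained in a maximal ideal `q`, then `x =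
  -- a / s`, being integral over the integrally closed domain `S_q`, would be a fraction `c / u`
  -- with `u` outside `q`. This yields a denominator `w * u` outside `q`.
  let I : Ideal S := 
    { carrier := {u | ∃ y : S, algebraMap S Q y = algebraMap S Q u * x}
      add_mem' := by
        rintro a b ⟨y, hy⟩ ⟨z, hz⟩
        exact ⟨y + z, by rw [map_add, hy, hz, map_add, add_mul]⟩
      zero_mem' := ⟨0, by simp⟩
      smul_mem' := by
        rintro c a ⟨y, hy⟩
        exact ⟨c * y, by rw [map_mul, hy, smul_eq_mul, map_mul, mul_assoc]⟩ }
  suffices I = ⊤ by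
    obtain ⟨y, hy⟩ := (Ideal.eq_top_iff_one I).1 this
    exact ⟨y, by simpa using hy⟩
  by_contra hI
  obtain ⟨q, hq, hIq⟩ := Ideal.exists_le_maximal I hI
  obtain ⟨h1, h2⟩ := h q
  obtain ⟨a, s, hs, hsa⟩ := hfrac x
  obtain ⟨P, hP, hPx⟩ := hx
  let D := Localization.AtPrime q
  let K := FractionRing D
  have hs0 : algebraMap S D (algebraMap R S s) ≠ 0 := by
    rw [Ne, IsLocalization.map_eq_zero_iff q.primeCompl]
    rintro ⟨w, hw⟩
    have : algebraMap S Q w = 0 := by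
      rw [IsScalarTower.algebraMap_apply R S Q] at hs
      rw [← hs.mul_left_eq_zero, ← map_mul, hw, map_zero]
    exact w.2 (by rw [hinj (this.trans (map_zero _).symm)]; exact zero_mem _)
  have hs0' : algebraMap D K (algebraMap S D (algebraMap R S s)) ≠ 0 := by
    rwa [Ne, FaithfulSMul.algebraMap_eq_zero_iff]
  -- clearing denominators in the integral equation of `x`
  have h3 : (P.scaleRoots s).eval₂ (algebraMap R S) (algebraMap R S a) = 0 := by
    refine hinj ?_
    rw [map_zero, Polynomial.hom_eval₂, ← IsScalarTower.algebraMap_eq,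
      ← IsScalarTower.algebraMap_apply, ← hsa]
    exact Polynomial.scaleRoots_eval₂_eq_zero _ hPx
  have h4 : P.eval₂ ((algebraMap D K).comp ((algebraMap S D).comp (algebraMap R S)))
      (algebraMap D K (algebraMap S D (algebraMap R S a)) /
        algebraMap D K (algebraMap S D (algebraMap R S s))) = 0 := by
    have := congrArg (algebraMap D K) (congrArg (algebraMap S D) h3)
    rw [Polynomial.hom_eval₂, Polynomial.hom_eval₂, map_zero, map_zero] at this
    refine eq_zero_of_ne_zero_of_mul_left_eq_zero (pow_ne_zero P.natDegree hs0') ?_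
    have h := Polynomial.scaleRoots_eval₂_mul (p := P)
      ((algebraMap D K).comp ((algebraMap S D).comp (algebraMap R S)))
      (algebraMap D K (algebraMap S D (algebraMap R S a)) /
        algebraMap D K (algebraMap S D (algebraMap R S s))) s
    rw [RingHom.comp_apply, RingHom.comp_apply, mul_div_cancel₀ _ hs0'] at h
    exact h.symm.trans this
  obtain ⟨d, hd⟩ := (isIntegrallyClosed_iff K).1 h2 (x := _)
    ⟨P.map ((algebraMap S D).comp (algebraMap R S)), hP.map _, by
      rw [Polynomial.eval₂_map]; exact h4⟩
  rw [eq_div_iff hs0', ← map_mul, (IsFractionRing.injective D K).eq_iff] at hd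
  obtain ⟨⟨c, u⟩, rfl⟩ := IsLocalization.mk'_surjective q.primeCompl d
  have h5 : algebraMap S D (c * algebraMap R S s) = algebraMap S D (u * algebraMap R S a) := by
    rw [map_mul, map_mul, ← hd, ← IsLocalization.mk'_spec' D c u, mul_assoc]
  obtain ⟨w, hw⟩ := (IsLocalization.eq_iff_exists q.primeCompl D).1 h5
  refine (w * u).2 (hIq ⟨w * c, ?_⟩)
  refine hs.mul_left_cancel ?_
  have := congrArg (algebraMap S Q) hw
  simp only [map_mul, ← IsScalarTower.algebraMap_apply, ← hsa] at this
  simp only [Submonoid.coe_mul, map_mul]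
  linear_combination this

end IntegralClosure

/-! ### Properties of relative spectra and the construction of the weak normalization -/

namespace QCohSubalgebra

variable {T X : Scheme.{u}} {f : T ⟶ X} (S : QCohSubalgebra f) [QuasiCompact f] [QuasiSeparated f]

lemma toBase_app (U : X.AffineZariskiSite) : S.toBase.app U.1 = S.unit U ≫ (S.objIso U).inv := by
  rw [Iso.eq_comp_inv]
  have : S.toBase.app U.1 ≫ (S.objIso U).hom ≫ S.incl U = S.unit U ≫ S.incl U := by
    rw [← S.fromSource_appLE, S.unit_incl, Scheme.Hom.app_eq_appLE, Scheme.Hom.appLE_comp_appLE,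
      Scheme.Hom.app_eq_appLE]
    simp_rw [S.fromSource_toBase]
  exact CommRingCat.hom_ext (RingHom.ext fun x ↦ Subtype.ext congr($this x))

lemma isIntegralHom_toBase (h : ∀ U, (S.unit U).hom.IsIntegral) : IsIntegralHom S.toBase where
  isIntegral_app U hU := by
    have := S.toBase_app ⟨U, hU⟩
    rw [this]
    refine (h ⟨U, hU⟩).trans _ _ (RingHom.isIntegral_of_surjective _ ?_)
    exact (S.objIso ⟨U, hU⟩).symm.commRingCatIsoToRingEquiv.surjective

lemma universallyInjective_toBase (h : ∀ U, PointInjective (S.unit U).hom) :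
    UniversallyInjective S.toBase := by
  rw [universallyInjective_iff_of_isAffineHom]
  intro U hU K _ α β hαβ
  have := S.toBase_app ⟨U, hU⟩
  rw [this] at hαβ
  have h2 := h ⟨U, hU⟩ K (α.comp (S.objIso ⟨U, hU⟩).inv.hom) (β.comp (S.objIso ⟨U, hU⟩).inv.hom)
    hαβ
  ext z
  obtain ⟨y, rfl⟩ := (S.objIso ⟨U, hU⟩).symm.commRingCatIsoToRingEquiv.surjective z
  exact congr($h2 y)

/-- The sections embed in those of `T`, so the kernel ideal vanishes on affine opens. Through this
the weak normalization inherits reducedness from the scheme of generic points. -/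
instance : IsSchemeTheoreticallyDominant S.fromSource where
  ker_eq_bot := by
    have : QuasiCompact S.fromSource := by
      have : QuasiCompact (S.fromSource ≫ S.toBase) := by rw [S.fromSource_toBase]; infer_instance
      exact .of_comp _ S.toBase
    refine Scheme.IdealSheafData.ext_of_iSup_eq_top
      (fun U : X.affineOpens ↦ ⟨S.toBase ⁻¹ᵁ U.1, U.2.preimage _⟩)
      (TopologicalSpace.IsOpenCover.comap (iSup_affineOpens_eq_top _) _) fun U ↦ ?_
    simp only [Scheme.Hom.ker_apply, Scheme.IdealSheafData.ideal_bot, Pi.bot_apply]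
    rw [← RingHom.injective_iff_ker_eq_bot]
    have h := S.fromSource_appLE_injective ⟨U.1, U.2⟩
    intro a b hab
    exact h (congrArg (T.presheaf.map _) hab)

end QCohSubalgebra

/-- The weak closure of a scheme in a scheme over it. -/
def weakSubalgebra {T X : Scheme.{u}} (f : T ⟶ X) [QuasiCompact f] [QuasiSeparated f] :
    QCohSubalgebra f where
  sections U :=
    letI := (f.app U.1).hom.toAlgebra
    (weakClosure Γ(X, U.1) Γ(T, f ⁻¹ᵁ U.1)).toSubring
  app_mem U r :=
    letI := (f.app U.1).hom.toAlgebra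
    (weakClosure Γ(X, U.1) Γ(T, f ⁻¹ᵁ U.1)).algebraMap_mem r
  map_mem U h t ht := by
    let i1 : Algebra Γ(X, U.1) Γ(T, f ⁻¹ᵁ U.1) := (f.app U.1).hom.toAlgebra
    let i2 : Algebra Γ(X, X.basicOpen h) Γ(T, f ⁻¹ᵁ X.basicOpen h) :=
      (f.app (X.basicOpen h)).hom.toAlgebra
    let i3 : Algebra Γ(T, f ⁻¹ᵁ U.1) Γ(T, f ⁻¹ᵁ X.basicOpen h) :=
      (T.presheaf.map (homOfLE (f.preimage_mono (X.basicOpen_le h))).op).hom.toAlgebra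
    let i4 : Algebra Γ(X, U.1) Γ(T, f ⁻¹ᵁ X.basicOpen h) :=
      ((algebraMap Γ(T, f ⁻¹ᵁ U.1) Γ(T, f ⁻¹ᵁ X.basicOpen h)).comp
        (algebraMap Γ(X, U.1) Γ(T, f ⁻¹ᵁ U.1))).toAlgebra
    let i5 : Algebra Γ(X, U.1) Γ(X, X.basicOpen h) :=
      (X.presheaf.map (homOfLE (X.basicOpen_le h)).op).hom.toAlgebra
    have : IsScalarTower Γ(X, U.1) Γ(T, f ⁻¹ᵁ U.1) Γ(T, f ⁻¹ᵁ X.basicOpen h) :=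
      .of_algebraMap_eq' rfl
    have : IsScalarTower Γ(X, U.1) Γ(X, X.basicOpen h) Γ(T, f ⁻¹ᵁ X.basicOpen h) :=
      .of_algebraMap_eq' congr($(f.naturality (homOfLE (X.basicOpen_le h)).op).hom).symm
    exact map_mem_weakClosure (R := Γ(X, U.1)) (R' := Γ(X, X.basicOpen h))
      (Q' := Γ(T, f ⁻¹ᵁ X.basicOpen h)) ht
  exists_pow_mul_mem U h t ht := by
    let i1 : Algebra Γ(X, U.1) Γ(T, f ⁻¹ᵁ U.1) := (f.app U.1).hom.toAlgebra
    let i2 : Algebra Γ(X, X.basicOpen h) Γ(T, f ⁻¹ᵁ X.basicOpen h) :=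
      (f.app (X.basicOpen h)).hom.toAlgebra
    let i3 : Algebra Γ(T, f ⁻¹ᵁ U.1) Γ(T, f ⁻¹ᵁ X.basicOpen h) :=
      (T.presheaf.map (homOfLE (f.preimage_mono (X.basicOpen_le h))).op).hom.toAlgebra
    let i4 : Algebra Γ(X, U.1) Γ(T, f ⁻¹ᵁ X.basicOpen h) :=
      ((algebraMap Γ(T, f ⁻¹ᵁ U.1) Γ(T, f ⁻¹ᵁ X.basicOpen h)).comp
        (algebraMap Γ(X, U.1) Γ(T, f ⁻¹ᵁ U.1))).toAlgebra
    let i5 : Algebra Γ(X, U.1) Γ(X, X.basicOpen h) :=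
      (X.presheaf.map (homOfLE (X.basicOpen_le h)).op).hom.toAlgebra
    have : IsScalarTower Γ(X, U.1) Γ(T, f ⁻¹ᵁ U.1) Γ(T, f ⁻¹ᵁ X.basicOpen h) :=
      .of_algebraMap_eq' rfl
    have : IsScalarTower Γ(X, U.1) Γ(X, X.basicOpen h) Γ(T, f ⁻¹ᵁ X.basicOpen h) :=
      .of_algebraMap_eq' congr($(f.naturality (homOfLE (X.basicOpen_le h)).op).hom).symm
    have h1 : IsLocalization.Away (algebraMap Γ(X, U.1) Γ(T, f ⁻¹ᵁ U.1) h)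
        Γ(T, f ⁻¹ᵁ X.basicOpen h) := QCohSubalgebra.isLocalization_away_app U h
    have h2 : IsLocalization.Away h Γ(X, X.basicOpen h) := U.2.isLocalization_basicOpen h
    exact exists_pow_mul_mem_weakClosure (R := Γ(X, U.1)) (R' := Γ(X, X.basicOpen h))
      (Q' := Γ(T, f ⁻¹ᵁ X.basicOpen h)) h t ht

variable (X : Scheme.{u}) [IsNoetherian X]

/-- The canonical model of the weak normalization. -/
def weakNormalization : Scheme.{u} := (weakSubalgebra (genericSchemeMap X)).glued

/-- The weak normalization morphism. -/
def weakNormalizationMap : weakNormalization X ⟶ X := (weakSubalgebra (genericSchemeMap X)).toBase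

/-- The canonical morphism from the generic scheme to the weak normalization. -/
def toWeakNormalization : genericScheme X ⟶ weakNormalization X :=
  (weakSubalgebra (genericSchemeMap X)).fromSource

lemma toWeakNormalization_weakNormalizationMap :
    toWeakNormalization X ≫ weakNormalizationMap X = genericSchemeMap X :=
  QCohSubalgebra.fromSource_toBase _

instance : IsSchemeTheoreticallyDominant (toWeakNormalization X) :=
  inferInstanceAs (IsSchemeTheoreticallyDominant (weakSubalgebra (genericSchemeMap X)).fromSource)

instance : IsIntegralHom (weakNormalizationMap X) :=
  QCohSubalgebra.isIntegralHom_toBase _ fun U ↦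
    letI := ((genericSchemeMap X).app U.1).hom.toAlgebra
    algebraMap_isIntegral_iff.2 (inferInstance : Algebra.IsIntegral Γ(X, U.1)
      (weakClosure Γ(X, U.1) Γ(genericScheme X, genericSchemeMap X ⁻¹ᵁ U.1)))

instance : UniversallyInjective (weakNormalizationMap X) :=
  QCohSubalgebra.universallyInjective_toBase _ fun U ↦
    letI := ((genericSchemeMap X).app U.1).hom.toAlgebra
    pointInjective_weakClosure (R := Γ(X, U.1))
      (Q := Γ(genericScheme X, genericSchemeMap X ⁻¹ᵁ U.1))

/-! ### The weak normalization -/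

lemma mem_genericPoints_iff {X : Type*} [TopologicalSpace X] [T0Space X] [QuasiSober X] {x : X} :
    x ∈ genericPoints X ↔ ∀ y, y ⤳ x → y = x := by
  constructor
  · intro hx y hy
    exact IsGenericPoint.eq (hy.closure_subset.antisymm' (hx.2 isIrreducible_singleton.closure
      hy.closure_subset)) rfl
  · intro h
    obtain ⟨y, hy⟩ := QuasiSober.sober (isIrreducible_irreducibleComponent (x := x))
      isClosed_irreducibleComponent
    have hx : x ∈ irreducibleComponent x := mem_irreducibleComponent (x := x)
    have h1 : y ⤳ x := specializes_iff_mem_closure.2 (hy.def.symm ▸ hx)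
    obtain rfl := h y h1
    change closure {y} ∈ irreducibleComponents X
    rw [hy.def]
    exact irreducibleComponent_mem_irreducibleComponents y

lemma apply_mem_genericPoints_iff {X Y : Scheme.{u}} (p : Y ⟶ X) (hp : IsHomeomorph p) (y : Y) :
    p y ∈ genericPoints X ↔ y ∈ genericPoints Y := by
  rw [mem_genericPoints_iff, mem_genericPoints_iff]
  constructor
  · exact fun h z hz ↦ hp.injective (h _ (hz.map hp.continuous))
  · intro h z hz
    obtain ⟨w, rfl⟩ := hp.surjective z
    rw [h w (hp.isInducing.specializes_iff.1 hz)]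

lemma residueFieldMap_bijective_of_comp {T Y X : Scheme.{u}} (q : T ⟶ Y) (p : Y ⟶ X) (t : T)
    (h : Function.Bijective ((q ≫ p).residueFieldMap t)) :
    Function.Bijective (p.residueFieldMap (q t)) := by
  refine ⟨RingHom.injective _, fun z ↦ ?_⟩
  obtain ⟨w, hw⟩ := h.2 (q.residueFieldMap t z)
  rw [Scheme.residueFieldMap_comp] at hw
  exact ⟨w, (RingHom.injective (q.residueFieldMap t).hom) hw⟩

variable {X : Scheme.{u}} [IsNoetherian X]

lemma quasiCompact_of_comp_eq_genericSchemeMap {Y : Scheme.{u}} (q : genericScheme X ⟶ Y)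
    (p : Y ⟶ X) [IsAffineHom p] (h : q ≫ p = genericSchemeMap X) : QuasiCompact q := by
  have : QuasiCompact (q ≫ p) := by rw [h]; infer_instance
  exact .of_comp _ p

lemma surjective_of_comp_eq_genericSchemeMap {X Y : Scheme.{u}} (q : genericScheme X ⟶ Y)
    (p : Y ⟶ X) [IsIntegralHom p] (h : q ≫ p = genericSchemeMap X) : Surjective p := by
  have : IsDominant (q ≫ p) := by rw [h]; infer_instance
  have : IsDominant p := .of_comp q p
  exact surjective_of_isDominant_of_isClosed_range _ p.isClosedMap.isClosed_range

/-- A universally injective integral morphism that receives a schematically dominant morphism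
from the generic scheme is a partial weak normalization. -/
lemma isPartialWeakNormalization_of_universallyInjective {Y : Scheme.{u}} (p : Y ⟶ X)
    [IsIntegralHom p] [UniversallyInjective p] (q : genericScheme X ⟶ Y)
    [IsSchemeTheoreticallyDominant q] (h : q ≫ p = genericSchemeMap X) :
    IsPartialWeakNormalization p := by
  have := quasiCompact_of_comp_eq_genericSchemeMap q p h
  have := surjective_of_comp_eq_genericSchemeMap q p h
  have hp := (isUniversalHomeomorphism_of_isIntegralHom p).isHomeomorph
  refine ⟨⟨IsSchemeTheoreticallyDominant.isReduced q, inferInstance, ⟨?_, hp.injective.injOn, ?_⟩,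
    fun y hy ↦ ?_⟩, hp.bijective, ?_⟩
  · exact fun y hy ↦ (apply_mem_genericPoints_iff p hp y).2 hy
  · intro x hx
    obtain ⟨y, rfl⟩ := hp.surjective x
    exact ⟨y, (apply_mem_genericPoints_iff p hp y).1 hx, rfl⟩
  · obtain ⟨t, ht⟩ := exists_genericSchemeMap_eq ((apply_mem_genericPoints_iff p hp y).2 hy)
    obtain rfl : q t = y := by
      refine hp.injective ?_
      rw [← Scheme.Hom.comp_apply, h, ht]
    refine residueFieldMap_bijective_of_comp q p t ?_
    have : SurjectiveOnStalks (q ≫ p) := by rw [h]; infer_instance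
    exact residueFieldMap_bijective_of_surjectiveOnStalks (q ≫ p) t
  · have := (tfae_universallyInjective p).out 0 2
    exact (this.1 ‹_›).2

variable (X) in
lemma isPartialWeakNormalization_weakNormalizationMap :
    IsPartialWeakNormalization (weakNormalizationMap X) :=
  isPartialWeakNormalization_of_universallyInjective _ _ (toWeakNormalization_weakNormalizationMap X)

/-- The generic points of `X` lift to generic points of `Y` with the same residue fields, so each
`Spec κ(η)` lifts. -/
lemma IsPartialNormalization.exists_lift {X Y : Scheme.{u}} {g : Y ⟶ X}
    (hg : IsPartialNormalization g) : ∃ q : genericScheme X ⟶ Y, q ≫ g = genericSchemeMap X := by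
  have (η : genericPoints X) : ∃ q : Spec (X.residueField η.1) ⟶ Y,
      q ≫ g = X.fromSpecResidueField η.1 := by
    obtain ⟨η, hη⟩ := η
    obtain ⟨y, hy, rfl⟩ := hg.bijOn_genericPoints.surjOn hη
    have : IsIso (g.residueFieldMap y) := by
      rw [ConcreteCategory.isIso_iff_bijective]
      exact hg.bijective_residueFieldMap y hy
    refine ⟨inv (Spec.map (g.residueFieldMap y)) ≫ Y.fromSpecResidueField y, ?_⟩
    rw [Category.assoc, IsIso.inv_comp_eq, Scheme.Hom.SpecMap_residueFieldMap_fromSpecResidueField]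
  choose q hq using this
  let q' : genericScheme X ⟶ Y := Sigma.desc q
  refine ⟨q', genericι_hom_ext X fun η ↦ ?_⟩
  have h : genericι X η ≫ q' = q η := Sigma.ι_desc q η
  rw [genericι_genericSchemeMap, ← hq, ← Category.assoc, h]

lemma IsPartialWeakNormalization.universallyInjective {Y X : Scheme.{u}} {g : Y ⟶ X}
    (hg : IsPartialWeakNormalization g) : UniversallyInjective g := by
  have := (tfae_universallyInjective g).out 0 2
  exact this.2 ⟨hg.bijective.injective, hg.isPurelyInseparable⟩

lemma comp_appLE_eq_app {T Y X : Scheme.{u}} {f : T ⟶ X} (q : T ⟶ Y) (g : Y ⟶ X)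
    (h : f = q ≫ g) (U : X.Opens) :
    g.app U ≫ q.appLE (g ⁻¹ᵁ U) (f ⁻¹ᵁ U) (by simp [h]) = f.app U := by
  rw [Scheme.Hom.app_eq_appLE, Scheme.Hom.appLE_comp_appLE, Scheme.Hom.app_eq_appLE]
  simp_rw [h]

variable (X) in
-- For domination, lift the generic scheme to `Y` and pull back functions along the lift. Since `Y →
-- X` is integral and injective on field-valued points, they land in the weak closure.
lemma isWeakNormalization_weakNormalizationMap : IsWeakNormalization (weakNormalizationMap X) where
  toIsPartialWeakNormalization := isPartialWeakNormalization_weakNormalizationMap X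
  dominates Y g hg := by
    have := hg.isIntegralHom
    have := hg.universallyInjective
    obtain ⟨q, hq⟩ := hg.exists_lift
    refine ⟨QCohSubalgebra.desc _ q g hq.symm fun U z ↦ ?_, QCohSubalgebra.desc_comp ..⟩
    let := ((genericSchemeMap X).app U.1).hom.toAlgebra
    exact mem_weakClosure_of_pointInjective (g.app U.1).hom (g.isIntegral_app U.1 U.2)
      ((universallyInjective_iff_of_isAffineHom g).1 inferInstance U.1 U.2)
      (q.appLE (g ⁻¹ᵁ U.1) (genericSchemeMap X ⁻¹ᵁ U.1) (by simp [← hq])).hom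
      congr($(comp_appLE_eq_app q g hq.symm U.1).hom) z

/-- Universal injectivity makes `a` and `b` agree on the spectra of all residue fields of `Z`, which
suffices because `Z` is reduced and `p` is separated. -/
lemma eq_of_comp_eq_of_universallyInjective {Z Y X : Scheme.{u}} [IsReduced Z] (p : Y ⟶ X)
    [IsSeparated p] [UniversallyInjective p] (a b : Z ⟶ Y) (h : a ≫ p = b ≫ p) : a = b := by
  refine ext_of_fromSpecResidueField_eq a b p Set.univ dense_univ (fun x _ ↦ ?_) h
  have := (tfae_universallyInjective p).out 0 1
  refine this.1 ‹_› (Z.residueField x) ?_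
  change (_ ≫ a) ≫ p = (_ ≫ b) ≫ p
  rw [Category.assoc, Category.assoc, h]

/-- By uniqueness, normality of an arbitrary weak normalization can be tested on the relative
spectrum of the weak closure. -/
lemma IsWeakNormalization.nonempty_iso {W W' X : Scheme.{u}} {g : W ⟶ X} {g' : W' ⟶ X}
    (h : IsWeakNormalization g) (h' : IsWeakNormalization g') : Nonempty (W ≅ W') := by
  have := h.isReduced
  have := h'.isReduced
  have := h.isIntegralHom
  have := h'.isIntegralHom
  have := h.universallyInjective
  have := h'.universallyInjective
  obtain ⟨a, ha⟩ := h.dominates _ g' h'.toIsPartialWeakNormalization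
  obtain ⟨b, hb⟩ := h'.dominates _ g h.toIsPartialWeakNormalization
  exact ⟨a, b, eq_of_comp_eq_of_universallyInjective g _ _ (by simp [ha, hb]),
    eq_of_comp_eq_of_universallyInjective g' _ _ (by simp [ha, hb])⟩

lemma IsNormal.of_iso {W W' : Scheme.{u}} (e : W ≅ W') (h : IsNormal W') : IsNormal W := by
  intro x
  obtain ⟨h1, h2⟩ := h (e.hom x)
  let i := (asIso (e.hom.stalkMap x)).commRingCatIsoToRingEquiv
  exact ⟨i.symm.toMulEquiv.isDomain _, .of_equiv i⟩

/-! ### Comparison of the weak normalization and the normalization -/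

variable {X : Scheme.{u}} [IsNoetherian X]

lemma pointInjective_comp_equiv_iff {R S S' : Type u} [CommRing R] [CommRing S] [CommRing S']
    (φ : R →+* S) (e : S ≃+* S') : PointInjective ((e : S →+* S').comp φ) ↔ PointInjective φ := by
  constructor
  · intro h K _ α β hαβ
    have := h K (α.comp (e.symm : S' →+* S)) (β.comp (e.symm : S' →+* S)) (by
      ext x
      simpa using congr($hαβ x))
    ext x
    simpa using congr($this (e x))
  · intro h K _ α β hαβ
    have := h K (α.comp (e : S →+* S')) (β.comp (e : S →+* S')) hαβ
    ext x
    simpa using congr($this (e.symm x))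

instance : IsIntegralHom (normalizationMap X) :=
  inferInstanceAs (IsIntegralHom (genericSchemeMap X).fromNormalization)

variable (X) in
/-- The canonical morphism from the generic scheme to the normalization. -/
def toNormalization : genericScheme X ⟶ normalization X := (genericSchemeMap X).toNormalization

lemma toNormalization_normalizationMap :
    toNormalization X ≫ normalizationMap X = genericSchemeMap X :=
  Scheme.Hom.toNormalization_fromNormalization _

instance : Surjective (normalizationMap X) :=
  surjective_of_comp_eq_genericSchemeMap _ _ toNormalization_normalizationMap

lemma isUniversalHomeomorphism_normalizationMap_iff_universallyInjective :
    IsUniversalHomeomorphism (normalizationMap X) ↔ UniversallyInjective (normalizationMap X) := by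
  exact ⟨fun h ↦ h.universallyInjective, fun h ↦ isUniversalHomeomorphism_of_isIntegralHom _⟩

lemma isUniversalHomeomorphism_normalizationMap_iff_pointInjective :
    IsUniversalHomeomorphism (normalizationMap X) ↔ ∀ U : X.Opens, IsAffineOpen U →
      letI := ((genericSchemeMap X).app U).hom.toAlgebra
      PointInjective (algebraMap Γ(X, U)
        (integralClosure Γ(X, U) Γ(genericScheme X, genericSchemeMap X ⁻¹ᵁ U))) := by
  rw [isUniversalHomeomorphism_normalizationMap_iff_universallyInjective,
    universallyInjective_iff_of_isAffineHom]
  refine forall₂_congr fun U hU ↦ ?_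
  let := ((genericSchemeMap X).app U).hom.toAlgebra
  have h : (normalizationMap X).app U = _ := (genericSchemeMap X).fromNormalization_app hU
  rw [h]
  exact pointInjective_comp_equiv_iff _
    ((genericSchemeMap X).normalizationObjIso hU).symm.commRingCatIsoToRingEquiv

lemma isUniversalHomeomorphism_normalizationMap_iff_weakClosure :
    IsUniversalHomeomorphism (normalizationMap X) ↔ ∀ U : X.Opens, IsAffineOpen U →
      letI := ((genericSchemeMap X).app U).hom.toAlgebra
      weakClosure Γ(X, U) Γ(genericScheme X, genericSchemeMap X ⁻¹ᵁ U) =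
        integralClosure Γ(X, U) Γ(genericScheme X, genericSchemeMap X ⁻¹ᵁ U) := by
  rw [isUniversalHomeomorphism_normalizationMap_iff_pointInjective]
  refine forall₂_congr fun U hU ↦ ?_
  let := ((genericSchemeMap X).app U).hom.toAlgebra
  exact weakClosure_eq_integralClosure_iff.symm

/-- Normality of the local rings at the points of an affine open can be read off from the
localizations of the ring of sections. -/
lemma forall_stalk_iff_forall_localization {W : Scheme.{u}} {V : W.Opens} (hV : IsAffineOpen V) :
    (∀ x ∈ V, IsDomain (W.presheaf.stalk x) ∧ IsIntegrallyClosed (W.presheaf.stalk x)) ↔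
      ∀ (q : Ideal Γ(W, V)) [q.IsPrime], IsDomain (Localization.AtPrime q) ∧
        IsIntegrallyClosed (Localization.AtPrime q) := by
  have key (q : PrimeSpectrum Γ(W, V)) (hq : hV.fromSpec q ∈ V) :
      Nonempty (W.presheaf.stalk (hV.fromSpec q) ≃+* Localization.AtPrime q.asIdeal) := by
    let := TopCat.Presheaf.algebra_section_stalk W.presheaf ⟨hV.fromSpec q, hq⟩
    have : IsLocalization.AtPrime (W.presheaf.stalk (hV.fromSpec q)) q.asIdeal :=
      hV.isLocalization_stalk' q hq
    exact ⟨(IsLocalization.algEquiv q.asIdeal.primeCompl _ _).toRingEquiv⟩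
  have hmem (q : PrimeSpectrum Γ(W, V)) : hV.fromSpec q ∈ V := by
    rw [← SetLike.mem_coe, ← hV.range_fromSpec]
    exact ⟨q, rfl⟩
  constructor
  · intro h q hq
    obtain ⟨e⟩ := key ⟨q, hq⟩ (hmem _)
    obtain ⟨h1, h2⟩ := h _ (hmem ⟨q, hq⟩)
    exact ⟨e.symm.toMulEquiv.isDomain _, .of_equiv e⟩
  · intro h x hx
    rw [← SetLike.mem_coe, ← hV.range_fromSpec] at hx
    obtain ⟨q, rfl⟩ := hx
    obtain ⟨e⟩ := key q (hmem _)
    have := q.2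
    obtain ⟨h1, h2⟩ := h q.asIdeal
    exact ⟨e.toMulEquiv.isDomain _, .of_equiv e.symm⟩

/-- If the local rings of the weak closure are integrally closed domains, every element of `Q`
integral over `R` already lies in it. Conversely, if it equals the integral closure, it is
integrally closed in the product of fields `Q`, which makes its local rings integrally closed
domains. -/
lemma isNormal_weakNormalization_iff : IsNormal (weakNormalization X) ↔
    IsUniversalHomeomorphism (normalizationMap X) := by
  rw [isUniversalHomeomorphism_normalizationMap_iff_weakClosure]
  have hle (U : X.Opens) : genericSchemeMap X ⁻¹ᵁ U ≤
      toWeakNormalization X ⁻¹ᵁ weakNormalizationMap X ⁻¹ᵁ U := by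
    rw [← Scheme.Hom.comp_preimage, toWeakNormalization_weakNormalizationMap]
  have key (U : X.Opens) (hU : IsAffineOpen U) :
      letI := ((genericSchemeMap X).app U).hom.toAlgebra
      (∀ (q : Ideal Γ(weakNormalization X, weakNormalizationMap X ⁻¹ᵁ U)) [q.IsPrime],
        IsDomain (Localization.AtPrime q) ∧ IsIntegrallyClosed (Localization.AtPrime q)) ↔
      weakClosure Γ(X, U) Γ(genericScheme X, genericSchemeMap X ⁻¹ᵁ U) =
        integralClosure Γ(X, U) Γ(genericScheme X, genericSchemeMap X ⁻¹ᵁ U) := by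
    let i1 := ((genericSchemeMap X).app U).hom.toAlgebra
    let i2 := ((weakNormalizationMap X).app U).hom.toAlgebra
    let i3 := ((toWeakNormalization X).appLE (weakNormalizationMap X ⁻¹ᵁ U)
      (genericSchemeMap X ⁻¹ᵁ U) (hle U)).hom.toAlgebra
    have : IsScalarTower Γ(X, U) Γ(weakNormalization X, weakNormalizationMap X ⁻¹ᵁ U)
        Γ(genericScheme X, genericSchemeMap X ⁻¹ᵁ U) :=
      .of_algebraMap_eq' congr($(comp_appLE_eq_app (toWeakNormalization X) (weakNormalizationMap X)
        (toWeakNormalization_weakNormalizationMap X).symm U).hom).symm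
    have hint : Algebra.IsIntegral Γ(X, U)
        Γ(weakNormalization X, weakNormalizationMap X ⁻¹ᵁ U) :=
      algebraMap_isIntegral_iff.1 ((weakNormalizationMap X).isIntegral_app U hU)
    have hinj : Function.Injective
        (algebraMap Γ(weakNormalization X, weakNormalizationMap X ⁻¹ᵁ U)
          Γ(genericScheme X, genericSchemeMap X ⁻¹ᵁ U)) :=
      QCohSubalgebra.fromSource_appLE_injective (weakSubalgebra (genericSchemeMap X)) ⟨U, hU⟩
    have hrange (x : Γ(genericScheme X, genericSchemeMap X ⁻¹ᵁ U)) :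
        (∃ y : Γ(weakNormalization X, weakNormalizationMap X ⁻¹ᵁ U), algebraMap _ _ y = x) ↔
          x ∈ weakClosure Γ(X, U) Γ(genericScheme X, genericSchemeMap X ⁻¹ᵁ U) :=
      SetLike.ext_iff.1 (QCohSubalgebra.range_fromSource_appLE
        (weakSubalgebra (genericSchemeMap X)) ⟨U, hU⟩) x
    constructor
    · intro h
      refine le_antisymm weakClosure_le fun x hx ↦ (hrange x).1 ?_
      exact exists_algebraMap_eq_of_isIntegrallyClosed_localization hinj h
        (exists_genericSchemeMap_app_mul_eq hU) x hx
    · intro h q hq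
      refine isIntegrallyClosed_localization_of_idempotents hinj (fun x hx ↦ ?_)
        (exists_idempotent_support hU) (fun x ↦ ?_) q
      · rw [hrange, h]
        exact isIntegral_trans (R := Γ(X, U)) x hx
      · obtain ⟨a, s, hs, hx⟩ := exists_genericSchemeMap_app_mul_eq hU x
        refine ⟨algebraMap _ _ a, algebraMap _ _ s, ?_⟩
        rw [← IsScalarTower.algebraMap_apply, ← IsScalarTower.algebraMap_apply]
        exact ⟨hs, hx⟩
  constructor
  · intro h U hU
    rw [← key U hU, ← forall_stalk_iff_forall_localization (hU.preimage (weakNormalizationMap X))]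
    exact fun x _ ↦ h x
  · intro h x
    obtain ⟨U, hU, hxU, -⟩ := exists_isAffineOpen_mem_and_subset
      (x := weakNormalizationMap X x) (U := ⊤) trivial
    exact (forall_stalk_iff_forall_localization (hU.preimage (weakNormalizationMap X))).2
      ((key U hU).2 (h U hU)) x hxU

/-! ### Geometrically unibranch local rings -/

section Unibranch

open IsLocalRing

/-- A homomorphism from a local ring is injective on the field-valued points over the closed
point. -/
def ClosedPointInjective {A N : Type u} [CommRing A] [IsLocalRing A] [CommRing N] (φ : A →+* N) :
    Prop :=
  ∀ (K : Type u) [Field K] (α β : N →+* K), α.comp φ = β.comp φ →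
    RingHom.ker (α.comp φ) = maximalIdeal A → α = β

lemma closedPointInjective_comp_equiv_iff {A N N' : Type u} [CommRing A] [IsLocalRing A]
    [CommRing N] [CommRing N'] (φ : A →+* N) (e : N ≃+* N') :
    ClosedPointInjective ((e : N →+* N').comp φ) ↔ ClosedPointInjective φ := by
  constructor
  · intro h K _ α β hαβ hα
    have := h K (α.comp (e.symm : N' →+* N)) (β.comp (e.symm : N' →+* N)) (by
      ext x
      simpa using congr($hαβ x)) (by
      rw [← hα]
      ext x
      simp)
    ext x
    simpa using congr($this (e x))
  · intro h K _ α β hαβ hα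
    have := h K (α.comp (e : N →+* N')) (β.comp (e : N →+* N')) hαβ hα
    ext x
    simpa using congr($this (e.symm x))

lemma comap_eq_maximalIdeal {A N : Type u} [CommRing A] [IsLocalRing A] [CommRing N]
    {φ : A →+* N} (hφ : φ.IsIntegral) (m : Ideal N) [m.IsMaximal] : m.comap φ = maximalIdeal A :=
  eq_maximalIdeal (Ideal.isMaximal_comap_of_isIntegral_of_isMaximal' φ hφ m)

/-- Maximal ideals `m`, `m'` of `N` both lie over that of `A`. An amalgam of `N ⧸ m` and `N ⧸ m'`
over the residue field of `A` gives two points of `N` agreeing on `A`; they are equal, hence so are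
their kernels. -/
lemma ClosedPointInjective.isLocalRing {A N : Type u} [CommRing A] [IsLocalRing A] [CommRing N]
    [Nontrivial N] {φ : A →+* N} (hφ : φ.IsIntegral) (h : ClosedPointInjective φ) :
    IsLocalRing N := by
  obtain ⟨m, hm⟩ := Ideal.exists_maximal N
  refine .of_unique_max_ideal ⟨m, hm, fun m' hm' ↦ ?_⟩
  have h1 := comap_eq_maximalIdeal hφ m
  have h2 := comap_eq_maximalIdeal hφ m'
  let := Ideal.Quotient.field m
  let := Ideal.Quotient.field m'
  obtain ⟨K, _, i, i', hi⟩ := exists_field_amalgam (k := ResidueField A) (L₁ := N ⧸ m)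
    (L₂ := N ⧸ m') (Ideal.quotientMap (I := maximalIdeal A) m φ h1.ge)
    (Ideal.quotientMap (I := maximalIdeal A) m' φ h2.ge)
  have hker : RingHom.ker (i.comp (Ideal.Quotient.mk m)) = m := by
    rw [RingHom.ker_comp_of_injective _ i.injective, Ideal.mk_ker]
  have hker' : RingHom.ker (i'.comp (Ideal.Quotient.mk m')) = m' := by
    rw [RingHom.ker_comp_of_injective _ i'.injective, Ideal.mk_ker]
  rw [← hker, ← hker']
  congr 1
  refine (h K _ _ ?_ ?_).symm
  · ext a
    exact congr($hi (residue A a))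
  · rw [← RingHom.comap_ker, hker, h1]

/-- An extension is purely inseparable if embeddings into an algebraic closure of the larger field
are determined by their restriction to the smaller one. -/
lemma ClosedPointInjective.exists_isPurelyInseparable {A N : Type u} [CommRing A] [IsLocalRing A]
    [CommRing N] [IsLocalRing N] {φ : A →+* N} (hφ : φ.IsIntegral) (h : ClosedPointInjective φ) :
    ∃ _ : IsLocalHom φ, (ResidueField.map φ).IsPurelyInseparable := by
  have hmax := comap_eq_maximalIdeal hφ (maximalIdeal N)
  have hloc : IsLocalHom φ := ((local_hom_TFAE φ).out 0 4).2 hmax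
  refine ⟨hloc, ?_⟩
  let := (ResidueField.map φ).toAlgebra
  have : Nonempty (ResidueField N →+* AlgebraicClosure (ResidueField N)) :=
    ⟨algebraMap (ResidueField N) (AlgebraicClosure (ResidueField N))⟩
  refine IsPurelyInseparable.of_injective_comp_algebraMap _ _ (AlgebraicClosure (ResidueField N))
    fun α β hαβ ↦ ?_
  refine Ideal.Quotient.ringHom_ext (h _ (α.comp (residue N)) (β.comp (residue N)) ?_ ?_)
  · ext a
    exact congr($hαβ (residue A a))
  · rw [← RingHom.comap_ker, RingHom.ker_comp_of_injective _ α.injective, ker_residue, hmax]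

/-- By integrality, a point over the closed point of `A` has a maximal kernel, so it factors through
the residue field of `N`. -/
lemma closedPointInjective_of_isPurelyInseparable {A N : Type u} [CommRing A] [IsLocalRing A]
    [CommRing N] [IsLocalRing N] {φ : A →+* N} (hφ : φ.IsIntegral) [IsLocalHom φ]
    (h : (ResidueField.map φ).IsPurelyInseparable) : ClosedPointInjective φ := by
  intro K _ α β hαβ hα
  have key (γ : N →+* K) (hγ : RingHom.ker (γ.comp φ) = maximalIdeal A) :
      RingHom.ker γ = maximalIdeal N := by
    have := RingHom.ker_isPrime γ
    refine eq_maximalIdeal (Ideal.isMaximal_of_isIntegral_of_isMaximal_comap' φ hφ _ ?_)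
    rw [RingHom.comap_ker, hγ]
    infer_instance
  have hα' := key α hα
  have hβ' := key β (hαβ ▸ hα)
  let := (ResidueField.map φ).toAlgebra
  have : IsPurelyInseparable (ResidueField A) (ResidueField N) := h
  let α' : ResidueField N →+* K := Ideal.Quotient.lift (maximalIdeal N) α fun a ha ↦ by
    rwa [← hα', RingHom.mem_ker] at ha
  let β' : ResidueField N →+* K := Ideal.Quotient.lift (maximalIdeal N) β fun a ha ↦ by
    rwa [← hβ', RingHom.mem_ker] at ha
  have : α' = β' := by
    refine IsPurelyInseparable.injective_comp_algebraMap (ResidueField A) (ResidueField N) K ?_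
    refine Ideal.Quotient.ringHom_ext ?_
    ext a
    exact congr($hαβ a)
  ext x
  exact congr($this (residue N x))

lemma toRedNormalization_isIntegral (A : Type u) [CommRing A] :
    (toRedNormalization A).IsIntegral :=
  (RingHom.isIntegral_of_surjective _ Ideal.Quotient.mk_surjective).trans _ _
    (algebraMap_isIntegral_iff.2 inferInstance)

/-- This restates locality and pure inseparability together in terms of field-valued points, so that
they can be compared with `PointInjective`. -/
lemma isGeometricallyUnibranchRing_iff (A : Type u) [CommRing A] [IsLocalRing A] :
    IsGeometricallyUnibranchRing A ↔
      IsDomain (Red A) ∧ ClosedPointInjective (toRedNormalization A) := by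
  refine and_congr_right fun _ ↦ ⟨?_, fun h ↦ ?_⟩
  · rintro ⟨_, _, h⟩
    exact closedPointInjective_of_isPurelyInseparable (toRedNormalization_isIntegral A) h
  · have := h.isLocalRing (toRedNormalization_isIntegral A)
    exact ⟨this, h.exists_isPurelyInseparable (toRedNormalization_isIntegral A)⟩

/-- If a field `F` is a localization of the total ring of fractions, then it is the fraction field
of the reduction. -/
lemma exists_redNormalization_equiv {A F : Type u} [CommRing A] [Field F] [Algebra A F]
    (hker : ∀ a : A, algebraMap A F a = 0 → IsNilpotent a)
    (hfrac : ∀ z : F, ∃ a s : A, algebraMap A F s ≠ 0 ∧ algebraMap A F s * z = algebraMap A F a) :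
    IsDomain (Red A) ∧ ∃ e : RedNormalization A ≃+* integralClosure A F,
      (e : RedNormalization A →+* integralClosure A F).comp (toRedNormalization A) =
        algebraMap A (integralClosure A F) := by
  let : Algebra (Red A) F := (Ideal.Quotient.lift (nilradical A) (algebraMap A F) fun a ha ↦
    ((mem_nilradical.1 ha).map (algebraMap A F)).eq_zero).toAlgebra
  have : IsScalarTower A (Red A) F := .of_algebraMap_eq' rfl
  have hinj : Function.Injective (algebraMap (Red A) F) := by
    rw [injective_iff_map_eq_zero]
    intro a ha
    obtain ⟨a, rfl⟩ := Ideal.Quotient.mk_surjective a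
    exact Ideal.Quotient.eq_zero_iff_mem.2 (hker a ha)
  have hdom : IsDomain (Red A) := hinj.isDomain _
  refine ⟨hdom, ?_⟩
  have : FaithfulSMul (Red A) F := (faithfulSMul_iff_algebraMap_injective _ _).2 hinj
  have : IsFractionRing (Red A) F := by
    refine IsFractionRing.of_field (Red A) F fun z ↦ ?_
    obtain ⟨a, s, hs, h⟩ := hfrac z
    refine ⟨Ideal.Quotient.mk _ a, Ideal.Quotient.mk _ s, ?_⟩
    change z = algebraMap A F a / algebraMap A F s
    rw [eq_div_iff hs, ← h, mul_comm]
  let i : FractionRing (Red A) ≃ₐ[Red A] F := FractionRing.algEquiv (Red A) F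
  have : Algebra.IsIntegral A (Red A) := inferInstance
  let e : RedNormalization A →+* integralClosure A F :=
    ((i : FractionRing (Red A) →+* F).comp (integralClosure (Red A) (FractionRing (Red A))).val.toRingHom).codRestrict
      (integralClosure A F) fun b ↦ isIntegral_trans (R := A) _ (b.2.map i)
  have he : Function.Bijective e := by
    constructor
    · intro a b hab
      exact Subtype.ext (i.injective congr($(hab).1))
    · rintro ⟨z, hz⟩
      exact ⟨⟨i.symm z, (hz.tower_top (A := Red A)).map i.symm⟩,
        Subtype.ext (i.apply_symm_apply z)⟩
  refine ⟨.ofBijective e he, ?_⟩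
  ext a
  exact i.commutes (Ideal.Quotient.mk _ a)

end Unibranch

/-! ### Unibranchness at a prime in terms of the integral closure before localization -/

section UnibranchLocalization

open IsLocalRing

variable {R Q A Q' : Type u} [CommRing R] [CommRing Q] [CommRing A] [CommRing Q'] [Algebra R Q]
  [Algebra R A] [Algebra Q Q']

lemma isField_of_idempotents [Nontrivial Q'] (P : Ideal R) [P.IsPrime]
    [IsLocalization (Algebra.algebraMapSubmonoid Q P.primeCompl) Q']
    (hsupp : ∀ a : Q, ∃ e b : Q, e * e = e ∧ e * a = a ∧ a * b = e)
    (hidem : ∀ e : Q, e * e = e → algebraMap Q Q' e = 0 ∨ algebraMap Q Q' e = 1) : IsField Q' := by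
  refine ⟨exists_pair_ne _, mul_comm, fun {z} hz ↦ ?_⟩
  obtain ⟨⟨a, s⟩, rfl⟩ := IsLocalization.mk'_surjective
    (Algebra.algebraMapSubmonoid Q P.primeCompl) z
  obtain ⟨e, b, he, hea, hab⟩ := hsupp a
  have h1 : algebraMap Q Q' e ≠ 0 := by
    refine fun h0 ↦ hz ?_
    dsimp only
    rw [IsLocalization.mk'_eq_iff_eq_mul, zero_mul, ← hea, map_mul, h0, zero_mul]
  refine ⟨algebraMap Q Q' (s * b), ?_⟩
  rw [map_mul, ← mul_assoc, IsLocalization.mk'_spec, ← map_mul, hab]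
  exact (hidem e he).resolve_left h1

lemma nontrivial_of_isLocalization_atPrime (P : Ideal R) [P.IsPrime]
    [IsLocalization (Algebra.algebraMapSubmonoid Q P.primeCompl) Q']
    (hker : ∀ r : R, algebraMap R Q r = 0 → IsNilpotent r) : Nontrivial Q' := by
  refine nontrivial_of_ne 1 0 fun h ↦ ?_
  rw [← map_one (algebraMap Q Q'), IsLocalization.map_eq_zero_iff
    (Algebra.algebraMapSubmonoid Q P.primeCompl)] at h
  obtain ⟨⟨_, s, hs, rfl⟩, h⟩ := h
  exact hs (nilradical_le_prime P (hker s (by simpa using h)))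

variable [Algebra R Q'] [Algebra A Q'] [IsScalarTower R Q Q'] [IsScalarTower R A Q']

/-- The integral closure localizes, and a point of it whose kernel in `R` is `P` sends `R ∖ P` to
units. So points over `P` and points over the closed point of `A` correspond. -/
lemma closedPointInjective_integralClosure_iff [IsLocalRing A] (P : Ideal R) [P.IsPrime]
    [IsLocalization.AtPrime A P]
    [IsLocalization (Algebra.algebraMapSubmonoid Q P.primeCompl) Q'] :
    ClosedPointInjective (algebraMap A (integralClosure A Q')) ↔
      ∀ (K : Type u) [Field K] (α β : integralClosure R Q →+* K),
        α.comp (algebraMap R _) = β.comp (algebraMap R _) →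
        RingHom.ker (α.comp (algebraMap R _)) = P → α = β := by
  let j : integralClosure R Q →+* integralClosure A Q' := integralClosureMap
  let := j.toAlgebra
  have hj : j.comp (algebraMap R _) = (algebraMap A _).comp (algebraMap R A) :=
    integralClosureMap_comp
  have hloc : IsLocalization (Algebra.algebraMapSubmonoid (integralClosure R Q) P.primeCompl)
      (integralClosure A Q') := isLocalization_integralClosureMap (Q := Q) P.primeCompl
  have hP : (maximalIdeal A).comap (algebraMap R A) = P :=
    IsLocalization.AtPrime.under_maximalIdeal A P
  constructor
  · intro h K _ α β hαβ hα
    have hunit (γ : integralClosure R Q →+* K) (hγ : RingHom.ker (γ.comp (algebraMap R _)) = P)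
        (y : Algebra.algebraMapSubmonoid (integralClosure R Q) P.primeCompl) : IsUnit (γ y) := by
      obtain ⟨_, s, hs, rfl⟩ := y
      refine IsUnit.mk0 _ fun h0 ↦ hs ?_
      rw [← hγ]
      exact h0
    let α' : integralClosure A Q' →+* K := IsLocalization.lift (hunit α hα)
    let β' : integralClosure A Q' →+* K := IsLocalization.lift (hunit β (hαβ ▸ hα))
    have hα' : α'.comp j = α := IsLocalization.lift_comp _
    have hβ' : β'.comp j = β := IsLocalization.lift_comp _
    have e (γ : integralClosure A Q' →+* K) : (γ.comp (algebraMap A _)).comp (algebraMap R A) =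
        (γ.comp j).comp (algebraMap R _) := by
      rw [RingHom.comp_assoc, RingHom.comp_assoc, hj]
    rw [← hα', ← hβ', h K α' β']
    · refine IsLocalization.ringHom_ext P.primeCompl ?_
      rw [e, e, hα', hβ', hαβ]
    · have h1 : (RingHom.ker (α'.comp (algebraMap A _))).comap (algebraMap R A) = P := by
        rw [RingHom.comap_ker, e, hα', hα]
      rw [← IsLocalization.map_under P.primeCompl A (maximalIdeal A),
        ← IsLocalization.map_under P.primeCompl A (RingHom.ker _)]
      exact congrArg (Ideal.map _) (h1.trans hP.symm)
  · intro h K _ α β hαβ hα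
    refine IsLocalization.ringHom_ext
      (Algebra.algebraMapSubmonoid (integralClosure R Q) P.primeCompl) (h K _ _ ?_ ?_)
    · change (α.comp j).comp _ = (β.comp j).comp _
      rw [RingHom.comp_assoc, RingHom.comp_assoc, hj, ← RingHom.comp_assoc, ← RingHom.comp_assoc,
        hαβ]
    · change RingHom.ker ((α.comp j).comp _) = P
      rw [RingHom.comp_assoc, hj, ← RingHom.comp_assoc, ← RingHom.comap_ker, hα, hP]

/-- Either side forces `Q'` to be a field: idempotents of `Q` become `0` or `1` there, because
`A_red` is a domain or because the integral closure is local. Once `Q'` is a field it is the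
fraction field of `A_red`, and the two integral closures coincide. -/
lemma isGeometricallyUnibranchRing_iff_closedPointInjective [IsReduced Q] [IsLocalRing A]
    (P : Ideal R) [P.IsPrime] [IsLocalization.AtPrime A P]
    [IsLocalization (Algebra.algebraMapSubmonoid Q P.primeCompl) Q']
    (hker : ∀ r : R, algebraMap R Q r = 0 → IsNilpotent r)
    (hfrac : ∀ x : Q, ∃ a s : R, IsUnit (algebraMap R Q s) ∧
      algebraMap R Q s * x = algebraMap R Q a)
    (hsupp : ∀ a : Q, ∃ e b : Q, e * e = e ∧ e * a = a ∧ a * b = e) :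
    IsGeometricallyUnibranchRing A ↔
      ClosedPointInjective (algebraMap A (integralClosure A Q')) := by
  have hnt : Nontrivial Q' := nontrivial_of_isLocalization_atPrime P hker
  have hred : IsReduced Q' := isReduced_localizationPreserves
    (Algebra.algebraMapSubmonoid Q P.primeCompl) Q' inferInstance
  have hA (r : R) : algebraMap A Q' (algebraMap R A r) = algebraMap Q Q' (algebraMap R Q r) := by
    rw [← IsScalarTower.algebraMap_apply, ← IsScalarTower.algebraMap_apply]
  have hfield (hF : IsField Q') : IsGeometricallyUnibranchRing A ↔
      ClosedPointInjective (algebraMap A (integralClosure A Q')) := by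
    let := hF.toField
    have hker' (a : A) (ha : algebraMap A Q' a = 0) : IsNilpotent a := by
      obtain ⟨⟨r, m⟩, rfl⟩ := IsLocalization.mk'_surjective P.primeCompl a
      have h1 : algebraMap Q Q' (algebraMap R Q r) = 0 := by
        rw [← hA, ← IsLocalization.mk'_spec A r m, map_mul, ha, zero_mul]
      rw [IsLocalization.map_eq_zero_iff (Algebra.algebraMapSubmonoid Q P.primeCompl)] at h1
      obtain ⟨⟨_, w, hw, rfl⟩, h1⟩ := h1
      have h2 := (hker (w * r) (by rw [map_mul]; exact h1)).map (algebraMap R A)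
      rw [map_mul, ← IsLocalization.mk'_spec A r m] at h2
      have hu : IsUnit (algebraMap R A w * algebraMap R A m) :=
        (IsLocalization.map_units A (⟨w, hw⟩ : P.primeCompl)).mul (IsLocalization.map_units A m)
      obtain ⟨n, hn⟩ := h2
      refine ⟨n, (hu.pow n).mul_right_cancel ?_⟩
      rw [← mul_pow, zero_mul, ← hn]
      congr 1
      ring
    have hfrac' (z : Q') : ∃ a s : A, algebraMap A Q' s ≠ 0 ∧
        algebraMap A Q' s * z = algebraMap A Q' a := by
      obtain ⟨⟨q, _, m, hm, rfl⟩, rfl⟩ := IsLocalization.mk'_surjective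
        (Algebra.algebraMapSubmonoid Q P.primeCompl) z
      obtain ⟨a, s, hs, hq⟩ := hfrac q
      refine ⟨algebraMap R A a, algebraMap R A (s * m), ?_, ?_⟩
      · rw [hA, map_mul, map_mul]
        exact ((hs.map _).mul (IsLocalization.map_units Q'
          (⟨_, m, hm, rfl⟩ : Algebra.algebraMapSubmonoid Q P.primeCompl))).ne_zero
      · rw [hA, hA, map_mul, map_mul, ← hq, map_mul, mul_assoc, mul_comm (algebraMap Q Q' _)
          (IsLocalization.mk' _ _ _)]
        congr 1
        exact IsLocalization.mk'_spec Q' q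
          (⟨_, m, hm, rfl⟩ : Algebra.algebraMapSubmonoid Q P.primeCompl)
    obtain ⟨hdom, e, he⟩ := exists_redNormalization_equiv hker' hfrac'
    rw [isGeometricallyUnibranchRing_iff, and_iff_right hdom,
      ← closedPointInjective_comp_equiv_iff _ e, he]
  refine ⟨fun h ↦ (hfield (isField_of_idempotents P hsupp fun e he ↦ ?_)).1 h,
    fun h ↦ (hfield (isField_of_idempotents P hsupp fun e he ↦ ?_)).2 h⟩
  · have := h.1
    obtain ⟨a, s, hs, hse⟩ := hfrac e
    -- With `e = a / s`, the relation `e * (1 - e) = 0` becomes `a * (s - a) = 0` in `Q`, and the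
    -- kernel of `R → Q` is nil.
    have h1 : IsNilpotent (a * (s - a)) := by
      refine hker _ ?_
      rw [map_mul, map_sub, ← hse]
      linear_combination -(algebraMap R Q s) ^ 2 * he
    have h2 : Ideal.Quotient.mk (nilradical A) (algebraMap R A a) *
        Ideal.Quotient.mk (nilradical A) (algebraMap R A (s - a)) = 0 := by
      rw [← map_mul, ← map_mul]
      exact Ideal.Quotient.eq_zero_iff_mem.2 (h1.map _)
    have h3 (r : R) (hr : Ideal.Quotient.mk (nilradical A) (algebraMap R A r) = 0) :
        algebraMap Q Q' (algebraMap R Q r) = 0 := by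
      rw [← hA]
      exact ((mem_nilradical.1 (Ideal.Quotient.eq_zero_iff_mem.1 hr)).map _).eq_zero
    have hs' := hs.map (algebraMap Q Q')
    rcases mul_eq_zero.1 h2 with h4 | h4
    · left
      have := h3 _ h4
      rwa [← hse, map_mul, hs'.mul_right_eq_zero] at this
    · right
      have := h3 _ h4
      rw [map_sub, map_sub, ← hse, map_mul, sub_eq_zero] at this
      exact (hs'.mul_left_cancel (by rw [mul_one, ← this]))
  · have := h.isLocalRing (algebraMap_isIntegral_iff.2 inferInstance)
    have he' : algebraMap Q Q' e * algebraMap Q Q' e = algebraMap Q Q' e := by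
      rw [← map_mul, he]
    let ε : integralClosure A Q' := ⟨algebraMap Q Q' e, ⟨.X ^ 2 - .X, by monicity!, by
      simp [pow_two, he']⟩⟩
    have hε : ε * (1 - ε) = 0 := Subtype.ext (by
      change algebraMap Q Q' e * (1 - algebraMap Q Q' e) = 0
      linear_combination -he')
    rcases isUnit_or_isUnit_one_sub_self ε with hu | hu
    · right
      exact congr($(sub_eq_zero.1 (hu.mul_right_eq_zero.1 hε)).1).symm
    · left
      exact congr($(hu.mul_left_eq_zero.1 hε).1)

end UnibranchLocalization

variable {X : Scheme.{u}} [IsNoetherian X]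

lemma isGeometricallyUnibranchRing_stalk_iff {U : X.Opens} (hU : IsAffineOpen U) (x : X)
    (hx : x ∈ U) :
    letI := ((genericSchemeMap X).app U).hom.toAlgebra
    IsGeometricallyUnibranchRing (X.presheaf.stalk x) ↔
      ∀ (K : Type u) [Field K] (α β : integralClosure Γ(X, U)
          Γ(genericScheme X, genericSchemeMap X ⁻¹ᵁ U) →+* K),
        α.comp (algebraMap Γ(X, U) _) = β.comp (algebraMap Γ(X, U) _) →
        RingHom.ker (α.comp (algebraMap Γ(X, U) _)) = (hU.primeIdealOf ⟨x, hx⟩).asIdeal →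
        α = β := by
  let := ((genericSchemeMap X).app U).hom.toAlgebra
  set P := (hU.primeIdealOf ⟨x, hx⟩).asIdeal
  let := TopCat.Presheaf.algebra_section_stalk X.presheaf ⟨x, hx⟩
  have : IsLocalization.AtPrime (X.presheaf.stalk x) P := hU.isLocalization_stalk ⟨x, hx⟩
  let Q : Type u := Γ(genericScheme X, genericSchemeMap X ⁻¹ᵁ U)
  let Q' := Localization (Algebra.algebraMapSubmonoid Q P.primeCompl)
  have hle : P.primeCompl ≤
      (Algebra.algebraMapSubmonoid Q P.primeCompl).comap (algebraMap Γ(X, U) Q) :=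
    Submonoid.le_comap_map P.primeCompl
  let : Algebra (X.presheaf.stalk x) Q' :=
    (IsLocalization.map Q' (algebraMap Γ(X, U) Q) hle : X.presheaf.stalk x →+* Q').toAlgebra
  have : IsScalarTower Γ(X, U) (X.presheaf.stalk x) Q' := .of_algebraMap_eq fun r ↦
    (IsScalarTower.algebraMap_apply Γ(X, U) Q Q' r).trans (IsLocalization.map_eq hle r).symm
  rw [isGeometricallyUnibranchRing_iff_closedPointInjective (Q := Q) (Q' := Q') P
    (fun r hr ↦ isNilpotent_of_app_eq_zero (genericSchemeMap X) hU r hr)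
    (exists_genericSchemeMap_app_mul_eq hU) (exists_idempotent_support hU)]
  exact closedPointInjective_integralClosure_iff P

/-- Two points of the integral closure that agree on `R` have the same kernel in `R`, which is the
prime of some `x` in `U`. So injectivity on all points is the unibranch condition at all `x`. -/
lemma isGeometricallyUnibranch_iff : IsGeometricallyUnibranch X ↔
    IsUniversalHomeomorphism (normalizationMap X) := by
  rw [isUniversalHomeomorphism_normalizationMap_iff_pointInjective]
  constructor
  · intro h U hU K _ α β hαβ
    let := ((genericSchemeMap X).app U).hom.toAlgebra
    let P : PrimeSpectrum Γ(X, U) := ⟨_, RingHom.ker_isPrime (α.comp (algebraMap Γ(X, U) _))⟩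
    have hx : hU.fromSpec P ∈ U := by
      rw [← SetLike.mem_coe, ← hU.range_fromSpec]
      exact ⟨P, rfl⟩
    refine (isGeometricallyUnibranchRing_stalk_iff hU _ hx).1 (h _) K α β hαβ ?_
    have : hU.primeIdealOf ⟨_, hx⟩ = P := hU.fromSpec.injective (hU.fromSpec_primeIdealOf ⟨_, hx⟩)
    rw [this]
  · intro h x
    obtain ⟨U, hU, hxU, -⟩ := exists_isAffineOpen_mem_and_subset (x := x) (U := ⊤) trivial
    exact (isGeometricallyUnibranchRing_stalk_iff hU x hxU).2 fun K _ α β hαβ _ ↦ h U hU K α β hαβ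

/-! ### Finite modifications are dominated by the normalization -/

section TopologicallyNormalOfNormalization

lemma universallyInjective_of_comp_of_surjective {W Y X : Scheme.{u}} (n : W ⟶ Y) (p : Y ⟶ X)
    [Surjective n] [UniversallyInjective (n ≫ p)] : UniversallyInjective p := by
  refine ⟨fun Y' X' a b p' H ↦ ?_⟩
  have h1 : Surjective (pullback.snd n a) := inferInstance
  have h2 : IsPullback (pullback.snd n a ≫ p') (pullback.fst n a) b (n ≫ p) :=
    (IsPullback.of_hasPullback n a).flip.paste_horiz H
  have : UniversallyInjective (pullback.snd n a ≫ p') :=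
    MorphismProperty.of_isPullback h2.flip ‹_›
  have h3 := (pullback.snd n a ≫ p').injective
  intro y z hyz
  obtain ⟨y, rfl⟩ := h1.surj y
  obtain ⟨z, rfl⟩ := h1.surj z
  rw [h3 (a₁ := y) (a₂ := z) (by simpa using hyz)]

lemma exists_genericPoints_specializes {X : Type*} [TopologicalSpace X] [QuasiSober X] (x : X) :
    ∃ η ∈ genericPoints X, η ⤳ x := by
  let η := genericPoints.ofComponent
    ⟨irreducibleComponent x, irreducibleComponent_mem_irreducibleComponents x⟩
  have hη := genericPoints.isGenericPoint_ofComponent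
    ⟨irreducibleComponent x, irreducibleComponent_mem_irreducibleComponents x⟩
  exact ⟨η.1, η.2, hη.specializes mem_irreducibleComponent⟩

/-- The local ring at a generic point has only one prime. It is thus minimal, and minimal primes of
a Noetherian ring are associated. -/
lemma isAssociatedPoint_of_mem_genericPoints {Y : Scheme.{u}} [IsLocallyNoetherian Y] {y : Y}
    (hy : y ∈ genericPoints Y) : IsAssociatedPoint Y y := by
  refine Module.associatedPrimes.minimalPrimes_annihilator_subset_associatedPrimes _ _ ?_
  have hmax : ∀ P : Ideal (Y.presheaf.stalk y), P.IsPrime →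
      P = IsLocalRing.maximalIdeal (Y.presheaf.stalk y) := by
    intro P hP
    let z : Spec (Y.presheaf.stalk y) := ⟨P, hP⟩
    have h1 : Y.fromSpecStalk y z ⤳ y := by
      have : Y.fromSpecStalk y z ∈ Set.range (Y.fromSpecStalk y) := ⟨z, rfl⟩
      rwa [Scheme.range_fromSpecStalk] at this
    have h2 := mem_genericPoints_iff.1 hy _ h1
    have h3 : z = IsLocalRing.closedPoint (Y.presheaf.stalk y) :=
      (Y.fromSpecStalk y).isEmbedding.injective (h2.trans Scheme.fromSpecStalk_closedPoint.symm)
    exact congrArg PrimeSpectrum.asIdeal h3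
  obtain ⟨P, hP, -⟩ := Ideal.exists_minimalPrimes_le (bot_le (a := IsLocalRing.maximalIdeal
    (Y.presheaf.stalk y)))
  have h0 : Module.annihilator (Y.presheaf.stalk y) (Y.presheaf.stalk y) = ⊥ :=
    Module.annihilator_eq_bot.2 inferInstance
  rw [h0, ← hmax P hP.1.1]
  exact hP

variable {X : Scheme.{u}} [IsNoetherian X]

lemma isNowhereDense_iff_disjoint_genericPoints {Z : Set X} (hZ : IsClosed Z) :
    IsNowhereDense Z ↔ Disjoint (genericPoints X) Z := by
  rw [hZ.isNowhereDense_iff, Set.disjoint_left]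
  constructor
  · intro h η hη hηZ
    have := finite_genericPoints X
    -- There are finitely many components, so the complement of the other ones is an open
    -- neighbourhood of `η`. Its points are specializations of `η`, hence lie in `Z` once `η` does.
    let C : Set X := ⋃ η' : {η' : genericPoints X // η'.1 ≠ η}, closure {η'.1.1}
    have hC : IsClosed C := isClosed_iUnion_of_finite fun _ ↦ isClosed_closure
    have h1 : Cᶜ ⊆ Z := by
      intro x hx
      obtain ⟨η', hη', h⟩ := exists_genericPoints_specializes x
      by_cases hηη' : η' = η
      · exact (hηη' ▸ h).mem_closed hZ hηZ
      · exact absurd (Set.mem_iUnion.2 ⟨⟨⟨η', hη'⟩, hηη'⟩, h.mem_closure⟩) hx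
    have h2 : η ∈ Cᶜ := by
      intro hη'
      obtain ⟨⟨η', hne⟩, h⟩ := Set.mem_iUnion.1 hη'
      exact hne (mem_genericPoints_iff.1 hη _ (specializes_iff_mem_closure.2 h))
    have : η ∈ interior Z := interior_maximal h1 hC.isOpen_compl h2
    simp [h] at this
  · intro h
    by_contra hne
    obtain ⟨x, hx⟩ := Set.nonempty_iff_ne_empty.2 hne
    obtain ⟨η, hη, hηx⟩ := exists_genericPoints_specializes x
    exact h hη (interior_subset (hηx.mem_open isOpen_interior hx))

/-- The generic scheme avoids `Z`, so it lifts along the inverse `σ` of `p` over `X ∖ Z`, and the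
normalization maps to `Y` by its universal property. This map is closed, and its image contains the
generic points of `Y`, which lie over `X ∖ Z` because they are associated. So it is surjective, and
`p` inherits universal injectivity from the composite. -/
lemma isTopologicallyNormal_of_isUniversalHomeomorphism
    (h : IsUniversalHomeomorphism (normalizationMap X)) : IsTopologicallyNormal X := by
  intro Z hZ Y p hp
  have := hp.isFinite
  have := hp.isIso_restrict
  have : IsLocallyNoetherian Y := LocallyOfFiniteType.isLocallyNoetherian p
  have hZ' := Set.disjoint_left.1 ((isNowhereDense_iff_disjoint_genericPoints Z.isClosed).1 hZ)
  let U : X.Opens := Z.compl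
  let σ : U.toScheme ⟶ Y := inv (p ∣_ U) ≫ (p ⁻¹ᵁ U).ι
  have hσ : σ ≫ p = U.ι := by simp [σ]
  have hσ' : ∀ y, p y ∈ U → ∃ x, σ x = y := by
    intro y hy
    refine ⟨(p ∣_ U) ⟨y, hy⟩, ?_⟩
    change ((p ∣_ U) ≫ σ) ⟨y, hy⟩ = y
    have : (p ∣_ U) ≫ σ = (p ⁻¹ᵁ U).ι := by simp [σ]
    rw [this]
    rfl
  have hrange : Set.range (genericSchemeMap X) ⊆ Set.range U.ι := by
    rintro _ ⟨t, rfl⟩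
    rw [Scheme.Opens.range_ι]
    exact hZ' (genericSchemeMap_mem t)
  let l : genericScheme X ⟶ U := IsOpenImmersion.lift U.ι (genericSchemeMap X) hrange
  have hl : l ≫ U.ι = genericSchemeMap X := IsOpenImmersion.lift_fac _ _ _
  have hq : genericSchemeMap X = (l ≫ σ) ≫ p := by rw [Category.assoc, hσ, hl]
  let n : normalization X ⟶ Y := (genericSchemeMap X).normalizationDesc (l ≫ σ) p hq
  have hn : n ≫ p = normalizationMap X := (genericSchemeMap X).normalizationDesc_comp _ _ hq
  have hn' : toNormalization X ≫ n = l ≫ σ :=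
    (genericSchemeMap X).toNormalization_normalizationDesc _ _ hq
  have : IsIntegralHom n := by
    have : IsIntegralHom (n ≫ p) := by rw [hn]; infer_instance
    exact .of_comp n p
  have hgen : ∀ y ∈ genericPoints Y, ∃ t, n t = y := by
    intro y hy
    obtain ⟨x, rfl⟩ := hσ' y
      (hp.notMem_of_isAssociatedPoint y (isAssociatedPoint_of_mem_genericPoints hy))
    have hx : U.ι x ∈ genericPoints X := by
      rw [mem_genericPoints_iff] at hy ⊢
      intro z hz
      obtain ⟨w, rfl⟩ : ∃ w, U.ι w = z := ⟨⟨z, hz.mem_open U.2 x.2⟩, rfl⟩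
      have hw : w ⤳ x := U.ι.isOpenEmbedding.isInducing.specializes_iff.1 hz
      have := hy _ (hw.map σ.continuous)
      have := congrArg p this
      rwa [← Scheme.Hom.comp_apply, ← Scheme.Hom.comp_apply, hσ] at this
    obtain ⟨t, ht⟩ := exists_genericSchemeMap_eq hx
    refine ⟨toNormalization X t, ?_⟩
    rw [← Scheme.Hom.comp_apply, hn', Scheme.Hom.comp_apply]
    congr 1
    refine U.ι.isOpenEmbedding.injective ?_
    rw [← ht, ← Scheme.Hom.comp_apply, hl]
  have : Surjective n := by
    refine ⟨fun y ↦ ?_⟩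
    obtain ⟨η, hη, hηy⟩ := exists_genericPoints_specializes y
    exact hηy.mem_closed n.isClosedMap.isClosed_range (hgen η hη)
  have : UniversallyInjective (n ≫ p) := by
    rw [hn]
    exact h.universallyInjective
  have := universallyInjective_of_comp_of_surjective n p
  have := surjective_of_comp_eq_genericSchemeMap _ _ hq.symm
  exact isUniversalHomeomorphism_of_isIntegralHom p

end TopologicallyNormalOfNormalization

/-! ### Multiplier rings of ideals -/

section MultiplierRing

variable {R Q R' Q' : Type u} [CommRing R] [CommRing Q] [CommRing R'] [CommRing Q']

/-- The elements of an `R`-algebra `Q` that map the image of an ideal of `R` to itself. -/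
def multiplierRing (j : R →+* Q) (J : Ideal R) : Subring Q where
  carrier := {c | ∀ r ∈ J, ∃ r' ∈ J, c * j r = j r'}
  mul_mem' {c d} hc hd r hr := by
    obtain ⟨s, hs, hs'⟩ := hd r hr
    obtain ⟨t, ht, ht'⟩ := hc s hs
    exact ⟨t, ht, by rw [mul_assoc, hs', ht']⟩
  one_mem' r hr := ⟨r, hr, one_mul _⟩
  add_mem' {c d} hc hd r hr := by
    obtain ⟨s, hs, hs'⟩ := hd r hr
    obtain ⟨t, ht, ht'⟩ := hc r hr
    exact ⟨t + s, J.add_mem ht hs, by rw [add_mul, hs', ht', map_add]⟩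
  zero_mem' _ _ := ⟨0, J.zero_mem, by rw [zero_mul, map_zero]⟩
  neg_mem' {c} hc r hr := by
    obtain ⟨t, ht, ht'⟩ := hc r hr
    exact ⟨-t, J.neg_mem ht, by rw [neg_mul, ht', map_neg]⟩

variable {j : R →+* Q} {J : Ideal R}

lemma map_mem_multiplierRing (r : R) : j r ∈ multiplierRing j J :=
  fun s hs ↦ ⟨r * s, J.mul_mem_left _ hs, (map_mul _ _ _).symm⟩

variable {j' : R' →+* Q'} {J' : Ideal R'} {ρ : R →+* R'} {σ : Q →+* Q'}

lemma map_multiplierRing (h : σ.comp j = j'.comp ρ) (hJ : J.map ρ = J') {c : Q}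
    (hc : c ∈ multiplierRing j J) : σ c ∈ multiplierRing j' J' := by
  subst hJ
  have h' (r : R) : σ (j r) = j' (ρ r) := congr($h r)
  intro r hr
  induction hr using Submodule.span_induction with
  | mem x hx =>
    obtain ⟨r, hr, rfl⟩ := hx
    obtain ⟨s, hs, hs'⟩ := hc r hr
    exact ⟨ρ s, Ideal.mem_map_of_mem _ hs, by rw [← h', ← h', ← hs', map_mul]⟩
  | zero => exact ⟨0, Ideal.zero_mem _, by simp⟩
  | add x y _ _ hx hy =>
    obtain ⟨a, ha, ha'⟩ := hx
    obtain ⟨b, hb, hb'⟩ := hy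
    exact ⟨a + b, Ideal.add_mem _ ha hb, by rw [map_add, map_add, mul_add, ha', hb']⟩
  | smul a x _ hx =>
    obtain ⟨b, hb, hb'⟩ := hx
    exact ⟨a * b, Ideal.mul_mem_left _ _ hb, by
      rw [smul_eq_mul, map_mul, map_mul, ← hb', mul_left_comm]⟩

/-- For each `r` in `J` some power of `a` moves `c * j r` into `j(J)`. The ideals `K n` of those `r`
for which the `n`-th power works increase with `n`, so Noetherianity gives one exponent for all of
`J`. -/
lemma exists_pow_mul_mem_multiplierRing [IsNoetherianRing R] (h : σ.comp j = j'.comp ρ)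
    (hJ : J.map ρ = J') (a : R) (hρ : letI := ρ.toAlgebra; IsLocalization.Away a R')
    (hσ : letI := σ.toAlgebra; IsLocalization.Away (j a) Q') {c : Q}
    (hc : σ c ∈ multiplierRing j' J') : ∃ n : ℕ, j a ^ n * c ∈ multiplierRing j J := by
  subst hJ
  let := ρ.toAlgebra
  let := σ.toAlgebra
  have h' (r : R) : σ (j r) = j' (ρ r) := congr($h r)
  let K : ℕ →o Ideal R :=
    { toFun n :=
        { carrier := {r | ∃ r' ∈ J, j a ^ n * (c * j r) = j r'}
          zero_mem' := ⟨0, J.zero_mem, by simp⟩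
          add_mem' := by
            rintro x y ⟨x', hx, hx'⟩ ⟨y', hy, hy'⟩
            exact ⟨x' + y', J.add_mem hx hy, by rw [map_add, map_add, mul_add, mul_add, hx', hy']⟩
          smul_mem' := by
            rintro b x ⟨x', hx, hx'⟩
            refine ⟨b * x', J.mul_mem_left _ hx, ?_⟩
            rw [smul_eq_mul, map_mul, map_mul, ← hx']
            ring }
      monotone' := by
        rintro m n hmn r ⟨r', hr, hr'⟩
        refine ⟨a ^ (n - m) * r', J.mul_mem_left _ hr, ?_⟩
        rw [map_mul, ← hr', map_pow, ← mul_assoc (j a ^ (n - m)), ← pow_add,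
          Nat.sub_add_cancel hmn] }
  obtain ⟨n, hn⟩ := monotone_stabilizes_iff_noetherian.2 ‹_› K
  refine ⟨n, fun r hr ↦ ?_⟩
  rw [mul_assoc]
  suffices H : ∃ m, r ∈ K m by
    obtain ⟨m, hm⟩ := H
    have h1 : r ∈ K (max n m) := K.monotone (le_max_right _ _) hm
    rwa [← hn _ (le_max_left _ _)] at h1
  obtain ⟨r₁, hr₁, hr₂⟩ := hc (ρ r) (Ideal.mem_map_of_mem _ hr)
  obtain ⟨⟨⟨r₂, hr₂J⟩, ⟨_, m, rfl⟩⟩, hr₃⟩ :=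
    (IsLocalization.mem_map_algebraMap_iff (Submonoid.powers a) R').1 hr₁
  have hr₃ : r₁ * ρ (a ^ m) = ρ r₂ := hr₃
  have h1 : σ (j a ^ m * (c * j r)) = σ (j r₂) := by
    rw [map_mul, map_mul, h' r, hr₂, h' r₂, ← hr₃, map_mul, mul_comm, ← h' (a ^ m), map_pow,
      map_pow, map_pow]
  obtain ⟨⟨_, k, rfl⟩, hk⟩ := (IsLocalization.eq_iff_exists (Submonoid.powers (j a)) Q').1 h1
  have hk : j a ^ k * (j a ^ m * (c * j r)) = j a ^ k * j r₂ := hk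
  exact ⟨k + m, a ^ k * r₂, J.mul_mem_left _ hr₂J, by
    rw [pow_add, mul_assoc, hk, map_mul, map_pow]⟩

/-- Multiplication embeds the multiplier ring into the Noetherian module of `R`-linear maps from `J`
to `j(J)`; injectivity is the hypothesis on `J`. -/
lemma finite_multiplierRing [IsNoetherianRing R] (hJ : ∀ c, (∀ r ∈ J, c * j r = 0) → c = 0) :
    (j.codRestrict (multiplierRing j J) map_mem_multiplierRing).Finite := by
  let := j.toAlgebra
  let := (j.codRestrict (multiplierRing j J) map_mem_multiplierRing).toAlgebra
  let N : Submodule R Q := Submodule.map (Algebra.linearMap R Q) J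
  have hsmul (r : R) (q : Q) : r • q = j r * q := rfl
  let Φ : multiplierRing j J →ₗ[R] J →ₗ[R] N :=
    { toFun c :=
        { toFun r := ⟨c.1 * j r.1, by
            obtain ⟨s, hs, hs'⟩ := c.2 r.1 r.2
            exact ⟨s, hs, hs'.symm⟩⟩
          map_add' x y := Subtype.ext (by simp [mul_add])
          map_smul' b x := Subtype.ext (by
            change c.1 * j (b * x.1) = j b * (c.1 * j x.1)
            rw [map_mul, mul_left_comm]) }
      map_add' c d := LinearMap.ext fun r ↦ Subtype.ext (add_mul _ _ _)
      map_smul' b c := LinearMap.ext fun r ↦ Subtype.ext (mul_assoc (j b) c.1 (j r.1)) }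
  have : Module.Finite R N := .map J _
  have hΦ : Function.Injective Φ := by
    rw [injective_iff_map_eq_zero]
    exact fun c hc ↦ Subtype.ext (hJ c.1 fun r hr ↦ congr(($hc ⟨r, hr⟩).1))
  have : IsNoetherian R (multiplierRing j J) := isNoetherian_of_injective Φ hΦ
  exact Module.IsNoetherian.finite R _

/-- An integral element that becomes a fraction `a / s` lifts to an element of the localization
away from `s` all of whose powers have a common denominator. -/
lemma exists_lift_away_of_isIntegral {L : Type u} [CommRing L] [Algebra R L] [Algebra R Q] (s a : R)
    [IsLocalization.Away s L] (ψ : L →+* Q) (hψ : ψ.comp (algebraMap R L) = algebraMap R Q)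
    (hker : ∀ r, algebraMap R Q r = 0 → IsNilpotent r) {b : Q} (hb : IsIntegral R b)
    (hab : algebraMap R Q s * b = algebraMap R Q a) :
    ∃ c : L, ψ c = b ∧ ∃ n : ℕ, ∀ k : ℕ, ∃ r, algebraMap R L (s ^ n) * c ^ k = algebraMap R L r := by
  have h' (r : R) : ψ (algebraMap R L r) = algebraMap R Q r := congr($hψ r)
  have hs : IsUnit (algebraMap R L s) := IsLocalization.Away.algebraMap_isUnit s
  obtain ⟨c, hc⟩ : ∃ c, algebraMap R L s * c = algebraMap R L a :=
    ⟨hs.unit⁻¹ * algebraMap R L a, by rw [← mul_assoc, hs.mul_val_inv, one_mul]⟩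
  have hcb : ψ c = b := by
    refine (hs.map ψ).mul_left_cancel ?_
    rw [← map_mul, hc, h', h', hab]
  obtain ⟨P, hP, hPb⟩ := hb
  -- `P` need not annihilate `c` itself, since `L` may not embed in `Q`. But its value there is
  -- nilpotent, so a power of `P` is an integral equation for `c`.
  have hq : ψ (Polynomial.eval₂ (algebraMap R L) c P) = 0 := by
    rw [Polynomial.hom_eval₂, hψ, hcb, hPb]
  obtain ⟨m, r, hr⟩ := IsLocalization.Away.surj s (Polynomial.eval₂ (algebraMap R L) c P)
  obtain ⟨N, hN⟩ := hker r (by rw [← h', ← hr, map_mul, hq, zero_mul])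
  have hqN : Polynomial.eval₂ (algebraMap R L) c P ^ N = 0 := by
    refine ((hs.pow m).pow N).mul_right_cancel ?_
    rw [← mul_pow, hr, ← map_pow, hN, map_zero, zero_mul]
  have hc' : IsIntegral R c := ⟨P ^ N, hP.pow N, by rw [Polynomial.eval₂_pow, hqN]⟩
  -- `R[c]` is a finite module, so one power of `s` clears the denominators of its generators and
  -- thereby of all powers of `c`.
  obtain ⟨F, hF⟩ := hc'.fg_adjoin_singleton
  obtain ⟨⟨_, n, rfl⟩, hn⟩ :=
    IsLocalization.exist_integer_multiples_of_finset (Submonoid.powers s) F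
  refine ⟨c, hcb, n, fun k ↦ ?_⟩
  have hck : c ^ k ∈ Submodule.span R (F : Set L) := by
    rw [hF]
    exact pow_mem (Algebra.self_mem_adjoin_singleton R c) k
  have H (x : L) (hx : x ∈ Submodule.span R (F : Set L)) :
      ∃ r, algebraMap R L (s ^ n) * x = algebraMap R L r := by
    induction hx using Submodule.span_induction with
    | mem x hx =>
      obtain ⟨r, hr⟩ := hn x hx
      exact ⟨r, by rw [hr, Algebra.smul_def]⟩
    | zero => exact ⟨0, by simp⟩
    | add x y _ _ hx hy =>
      obtain ⟨u, hu⟩ := hx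
      obtain ⟨v, hv⟩ := hy
      exact ⟨u + v, by rw [mul_add, hu, hv, map_add]⟩
    | smul z x _ hx =>
      obtain ⟨u, hu⟩ := hx
      exact ⟨z * u, by rw [Algebra.smul_def, mul_left_comm, hu, map_mul]⟩
  exact H _ hck

end MultiplierRing

/-! ### The finite modification attached to an ideal sheaf -/

section MultiplierSubalgebra

/-- The basic opens of `W` inside `U` cover `U ⊓ W`, and `h` is invertible on its own basic open, so
all germs of `c` vanish. -/
lemma eq_zero_of_forall_pow_mul_eq_zero {X : Scheme.{u}} {U W : X.Opens} (hW : IsAffineOpen W)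
    (c : Γ(U.toScheme, U.ι ⁻¹ᵁ W))
    (hc : ∀ h : Γ(X, W), X.basicOpen h ≤ U → ∃ n : ℕ, U.ι.app W h ^ n * c = 0) : c = 0 := by
  refine TopCat.Presheaf.section_ext U.toScheme.sheaf _ _ _ fun x hx ↦ ?_
  obtain ⟨h, hhU, hxh⟩ := hW.exists_basicOpen_le
    (⟨x.1, ⟨x.2, hx⟩⟩ : (U ⊓ W : X.Opens)) hx
  obtain ⟨n, hn⟩ := hc h (hhU.trans inf_le_left)
  have h1 : x ∈ U.toScheme.basicOpen (U.ι.app W h) := by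
    rw [← Scheme.preimage_basicOpen]
    exact hxh
  have h2 := (RingedSpace.mem_basicOpen _ _ x hx).1 h1
  have h3 := congrArg (U.toScheme.presheaf.germ (U.ι ⁻¹ᵁ W) x hx) hn
  rw [map_mul, map_pow, map_zero] at h3
  have h4 := (h2.pow n).mul_right_eq_zero.1 h3
  exact h4.trans (map_zero (U.toScheme.presheaf.germ (U.ι ⁻¹ᵁ W) x hx).hom).symm

variable {T X : Scheme.{u}} [IsLocallyNoetherian X]

/-- The quasi-coherent algebra of functions multiplying the image of an ideal sheaf to itself. -/
def multiplierSubalgebra (f : T ⟶ X) [QuasiCompact f] [QuasiSeparated f] (J : X.IdealSheafData) :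
    QCohSubalgebra f where
  sections W := multiplierRing (f.app W.1).hom (J.ideal ⟨W.1, W.2⟩)
  app_mem _ r := map_mem_multiplierRing r
  map_mem W h _ ht := map_multiplierRing
    (congr($(f.naturality (homOfLE (X.basicOpen_le h)).op).hom)).symm
    (J.map_ideal_basicOpen ⟨W.1, W.2⟩ h) ht
  exists_pow_mul_mem W h _ ht := by
    have : IsNoetherianRing Γ(X, W.1) := IsLocallyNoetherian.component_noetherian ⟨W.1, W.2⟩
    exact exists_pow_mul_mem_multiplierRing
      (congr($(f.naturality (homOfLE (X.basicOpen_le h)).op).hom)).symm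
      (J.map_ideal_basicOpen ⟨W.1, W.2⟩ h) h (W.2.isLocalization_basicOpen h)
      (QCohSubalgebra.isLocalization_away_app W h) ht

variable {U : X.Opens} {J : X.IdealSheafData}

lemma exists_pow_mem_ideal {X : Scheme.{u}} {U : X.Opens} {J : X.IdealSheafData}
    (hJ : ∀ W : X.affineOpens, W.1 ≤ U → J.ideal W = ⊤)
    (W : X.affineOpens)
    {h : Γ(X, W.1)} (hh : X.basicOpen h ≤ U) : ∃ n : ℕ, h ^ n ∈ J.ideal W := by
  let := (X.presheaf.map (homOfLE (X.basicOpen_le h)).op).hom.toAlgebra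
  have : IsLocalization.Away h Γ(X, X.basicOpen h) := W.2.isLocalization_basicOpen h
  have h1 : (1 : Γ(X, X.basicOpen h)) ∈
      (J.ideal W).map (algebraMap Γ(X, W.1) Γ(X, X.basicOpen h)) := by
    have h0 : (J.ideal W).map (algebraMap Γ(X, W.1) Γ(X, X.basicOpen h)) = ⊤ :=
      (J.map_ideal_basicOpen W h).trans (hJ (X.affineBasicOpen h) hh)
    rw [h0]
    trivial
  obtain ⟨⟨⟨r, hr⟩, ⟨_, m, rfl⟩⟩, h2⟩ :=
    (IsLocalization.mem_map_algebraMap_iff (Submonoid.powers h) _).1 h1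
  have h2 : algebraMap Γ(X, W.1) Γ(X, X.basicOpen h) (h ^ m) = algebraMap _ _ r := by
    rw [← h2, one_mul]
  obtain ⟨⟨_, k, rfl⟩, hk⟩ := (IsLocalization.eq_iff_exists (Submonoid.powers h) _).1 h2
  have hk : h ^ k * h ^ m = h ^ k * r := hk
  exact ⟨k + m, by rw [pow_add, hk]; exact Ideal.mul_mem_left _ _ hr⟩

variable [QuasiCompact U.ι]

/-- No nonzero function on `U ⊓ W` is killed by `J`: the ideal contains a power of each `h` whose
basic open lies in `U`. -/
lemma isFinite_toBase_multiplierSubalgebra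
    (hJ : ∀ W : X.affineOpens, W.1 ≤ U → J.ideal W = ⊤) :
    IsFinite (multiplierSubalgebra U.ι J).toBase := by
  let S := multiplierSubalgebra U.ι J
  refine { finite_app := fun W hW ↦ ?_ }
  have := S.toBase_app ⟨W, hW⟩
  rw [this]
  have : IsNoetherianRing Γ(X, W) := IsLocallyNoetherian.component_noetherian ⟨W, hW⟩
  have h1 : (S.unit ⟨W, hW⟩).hom.Finite := by
    refine finite_multiplierRing (j := (U.ι.app W).hom) (J := J.ideal ⟨W, hW⟩) fun c hc ↦ ?_
    refine eq_zero_of_forall_pow_mul_eq_zero hW c fun h hh ↦ ?_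
    obtain ⟨n, hn⟩ := exists_pow_mem_ideal hJ ⟨W, hW⟩ hh
    exact ⟨n, by rw [← map_pow, mul_comm]; exact hc _ hn⟩
  exact RingHom.Finite.comp (RingHom.Finite.of_surjective _
    (S.objIso ⟨W, hW⟩).symm.commRingCatIsoToRingEquiv.surjective) h1

lemma isIso_morphismRestrict_of_isIso_app {Y X : Scheme.{u}} (p : Y ⟶ X) [IsAffineHom p]
    (U : X.Opens) (h : ∀ W : X.Opens, IsAffineOpen W → W ≤ U → IsIso (p.app W)) :
    IsIso (p ∣_ U) := by
  refine IsZariskiLocalAtTarget.of_forall_exists_morphismRestrict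
    (P := MorphismProperty.isomorphisms Scheme.{u}) fun x ↦ ?_
  obtain ⟨W, hW, hxW, -⟩ := exists_isAffineOpen_mem_and_subset (U := ⊤) (x := x) trivial
  refine ⟨W, hxW, (MorphismProperty.arrow_mk_iso_iff _ (morphismRestrictRestrict p U W)).2 ?_⟩
  have hW' : IsAffineOpen (U.ι ''ᵁ W) := hW.image_of_isOpenImmersion U.ι
  exact (isIso_morphismRestrict_iff_isIso_app p hW').2 (h _ hW' (U.ι_image_le W))

lemma isIso_toBase_multiplierSubalgebra_restrict :
    IsIso ((multiplierSubalgebra U.ι J).toBase ∣_ U) := by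
  let S := multiplierSubalgebra U.ι J
  refine isIso_morphismRestrict_of_isIso_app _ _ fun W hW hWU ↦ ?_
  have h0 := S.toBase_app ⟨W, hW⟩
  have h1 : IsIso (U.ι.app W) := U.ι.isIso_app W (by rwa [Scheme.Opens.opensRange_ι])
  have h2 : Function.Bijective (U.ι.app W).hom := (ConcreteCategory.isIso_iff_bijective _).1 h1
  have h3 : IsIso (S.unit ⟨W, hW⟩) := by
    rw [ConcreteCategory.isIso_iff_bijective]
    refine ⟨fun a b hab ↦ h2.1 (congrArg Subtype.val hab), fun c ↦ ?_⟩
    obtain ⟨r, hr⟩ := h2.2 c.1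
    exact ⟨r, Subtype.ext hr⟩
  rw [h0]
  infer_instance

/-- Choose `w` in `M` so that the ideal of `h` with `w * (φ h * c) = 0` is maximal. Replacing `w` by
`w * v` cannot enlarge it, so it already contains every `h` killed with the help of some `v`. -/
lemma exists_common_multiplier {A B : Type u} [CommRing A] [IsNoetherianRing A] [CommRing B]
    (φ : A →+* B) (M : Submonoid B) (c : B) : ∃ w ∈ M, ∀ h : A,
      (∃ v ∈ M, v * (φ h * c) = 0) → w * (φ h * c) = 0 := by
  let I (w : B) : Ideal A :=
    { carrier := {h | w * (φ h * c) = 0}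
      zero_mem' := by simp
      add_mem' {x y} hx hy := by
        simp only [Set.mem_ofPred_eq] at hx hy ⊢
        rw [map_add, add_mul, mul_add, hx, hy, add_zero]
      smul_mem' a {x} hx := by
        simp only [Set.mem_ofPred_eq] at hx ⊢
        rw [smul_eq_mul, map_mul, mul_assoc, mul_left_comm, hx, mul_zero] }
  obtain ⟨_, ⟨w, hw, rfl⟩, hmax⟩ := set_has_maximal_iff_noetherian.2 ‹_› (I '' M)
    ⟨_, 1, M.one_mem, rfl⟩
  refine ⟨w, hw, fun h ⟨v, hv, hvh⟩ ↦ ?_⟩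
  have h1 : I w ≤ I (w * v) := fun a (ha : w * (φ a * c) = 0) ↦ by
    change w * v * (φ a * c) = 0
    rw [mul_right_comm, ha, zero_mul]
  have h2 : h ∈ I (w * v) := by
    change w * v * (φ h * c) = 0
    rw [mul_assoc, hvh, mul_zero]
  rwa [← eq_of_le_of_not_lt h1 (hmax _ ⟨_, M.mul_mem hw hv, rfl⟩)] at h2

/-- Let the annihilator of `z` be the maximal ideal at a point `y` outside the preimage of `U`.
Every `h` whose basic open lies in `U` is a nonunit at `y`, so it kills `z`. Clearing denominators
uniformly in `h` gives a section `w * c` killed by all these `h`, hence zero on `U`. Sections embed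
in functions on `U`, so `w * c = 0` and `z = 0`, a contradiction. -/
lemma mem_of_isAssociatedPoint_multiplierSubalgebra
    (hJ : ∀ W : X.affineOpens, W.1 ≤ U → J.ideal W = ⊤) (y : (multiplierSubalgebra U.ι J).glued)
    (hy : IsAssociatedPoint _ y) : (multiplierSubalgebra U.ι J).toBase y ∈ U := by
  let S := multiplierSubalgebra U.ι J
  by_contra hyU
  have : IsFinite S.toBase := isFinite_toBase_multiplierSubalgebra hJ
  have : IsLocallyNoetherian S.glued := LocallyOfFiniteType.isLocallyNoetherian S.toBase
  obtain ⟨W, hW, hyW, -⟩ :=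
    exists_isAffineOpen_mem_and_subset (U := ⊤) (x := S.toBase y) trivial
  have : IsNoetherianRing Γ(X, W) := IsLocallyNoetherian.component_noetherian ⟨W, hW⟩
  have hV : IsAffineOpen (S.toBase ⁻¹ᵁ W) := hW.preimage S.toBase
  let g := (S.glued.presheaf.germ (S.toBase ⁻¹ᵁ W) y hyW).hom
  let φ := (S.toBase.app W).hom
  let := g.toAlgebra
  let q := (hV.primeIdealOf ⟨y, hyW⟩).asIdeal
  have hloc : IsLocalization.AtPrime (S.glued.presheaf.stalk y) q :=
    hV.isLocalization_stalk ⟨y, hyW⟩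
  obtain ⟨hprime, z, hz⟩ := isAssociatedPrime_iff.1 hy
  have hz' (r : S.glued.presheaf.stalk y) : r ∈ IsLocalRing.maximalIdeal _ ↔ r * z = 0 := by
    rw [hz, Submodule.mem_colon_singleton, Submodule.mem_bot, smul_eq_mul]
  obtain ⟨⟨c, v⟩, hcv⟩ := IsLocalization.surj q.primeCompl z
  have hcv : z * g v = g c := hcv
  obtain ⟨w, hw, hw'⟩ := exists_common_multiplier φ q.primeCompl c
  have h1 (h : Γ(X, W)) (hh : X.basicOpen h ≤ U) : φ h * (w * c) = 0 := by
    rw [mul_left_comm]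
    refine hw' h ?_
    have h2 : g (φ h) ∈ IsLocalRing.maximalIdeal (S.glued.presheaf.stalk y) := by
      intro hu
      have h3 : y ∈ S.glued.basicOpen (φ h) := (RingedSpace.mem_basicOpen _ _ y hyW).2 hu
      rw [← Scheme.preimage_basicOpen] at h3
      exact hyU (hh h3)
    have h3 : algebraMap _ (S.glued.presheaf.stalk y) (φ h * c) = 0 := by
      change g (φ h * c) = 0
      rw [map_mul, ← hcv, ← mul_assoc, (hz' _).1 h2, zero_mul]
    obtain ⟨⟨v', hv'⟩, h4⟩ := (IsLocalization.map_eq_zero_iff q.primeCompl _ _).1 h3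
    exact ⟨v', hv', h4⟩
  let θ := S.fromSource.appLE (S.toBase ⁻¹ᵁ W) (U.ι ⁻¹ᵁ W) (S.preimage_le_fromSource_preimage W)
  have hθ (h : Γ(X, W)) : θ (φ h) = U.ι.app W h := by
    have := comp_appLE_eq_app S.fromSource S.toBase S.fromSource_toBase.symm W
    exact congr($this h)
  have h5 : θ (w * c) = 0 := by
    refine eq_zero_of_forall_pow_mul_eq_zero hW _ fun h hh ↦ ⟨1, ?_⟩
    rw [pow_one, ← hθ, ← map_mul, h1 h hh, map_zero]
  have h6 : w * c = 0 := S.fromSource_appLE_injective ⟨W, hW⟩ (h5.trans (map_zero θ.hom).symm)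
  have h7 : g c = 0 := by
    refine (IsLocalization.map_units (S.glued.presheaf.stalk y)
      (⟨w, hw⟩ : q.primeCompl)).mul_left_cancel ?_
    change g w * g c = g w * 0
    rw [← map_mul, h6, map_zero, mul_zero]
  have h8 : z = 0 := by
    refine (IsLocalization.map_units (S.glued.presheaf.stalk y) v).mul_right_cancel ?_
    change z * g v = 0 * g v
    rw [hcv, h7, zero_mul]
  exact hprime.ne_top ((Ideal.eq_top_iff_one _).2 ((hz' 1).2 (by rw [h8, mul_zero])))

/-- The relative spectrum of the multiplier algebra of an ideal sheaf that is trivial on `U` is a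
finite modification centered at the complement of `U`. -/
lemma isFiniteModification_toBase_multiplierSubalgebra {Z : Closeds X} (hZ : Z.compl = U)
    (hJ : ∀ W : X.affineOpens, W.1 ≤ U → J.ideal W = ⊤) :
    IsFiniteModification (multiplierSubalgebra U.ι J).toBase Z where
  isFinite := isFinite_toBase_multiplierSubalgebra hJ
  notMem_of_isAssociatedPoint y hy hyZ := by
    have h := mem_of_isAssociatedPoint_multiplierSubalgebra hJ y hy
    exact hZ.symm.le h hyZ
  isIso_restrict := by
    rw [show (Z.compl : X.Opens) = U from hZ]
    exact isIso_toBase_multiplierSubalgebra_restrict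

end MultiplierSubalgebra

/-! ### From topological normality to the normalization -/

section NormalizationOfTopologicallyNormal

variable {X : Scheme.{u}}

/-- An ideal of the ring of sections over an affine open that is trivial on an open subset extends
to an ideal sheaf that is trivial on this open subset. -/
lemma exists_idealSheafData [IsLocallyNoetherian X] {V U : X.Opens} (hV : IsAffineOpen V)
    (I : Ideal Γ(X, V)) (s : Γ(X, V)) (hs : s ∈ I.radical) (hU : U ⊓ V ≤ X.basicOpen s) :
    ∃ J : X.IdealSheafData, J.ideal ⟨V, hV⟩ = I ∧
      ∀ W : X.affineOpens, W.1 ≤ U → J.ideal W = ⊤ := by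
  let π : Γ(X, V) ⟶ .of (Γ(X, V) ⧸ I) := CommRingCat.ofHom (Ideal.Quotient.mk I)
  -- The kernel of this morphism is the desired ideal sheaf. It is trivial on `U` because `s` is
  -- nilpotent modulo `I`, so the image misses the basic open of `s` and with it `U`.
  let i : Spec (.of (Γ(X, V) ⧸ I)) ⟶ X := Spec.map π ≫ hV.fromSpec
  have : QuasiCompact i := inferInstance
  have hiV : i ⁻¹ᵁ V = ⊤ := by
    rw [Scheme.Hom.comp_preimage, hV.fromSpec_preimage_self]
    rfl
  refine ⟨i.ker, ?_, fun W hW ↦ ?_⟩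
  · have h1 : hV.fromSpec.appLE V ⊤ hV.fromSpec_preimage_self.ge = (Scheme.ΓSpecIso _).inv := by
      rw [Scheme.Hom.appLE, hV.fromSpec_app_self, Category.assoc]
      refine (congrArg (_ ≫ ·) ?_).trans (Category.comp_id _)
      refine (((Spec Γ(X, V)).presheaf.map_comp _ _).symm).trans ?_
      exact (Spec Γ(X, V)).presheaf.map_id _
    have h2 : i.appLE V ⊤ hiV.ge = π ≫ (Scheme.ΓSpecIso _).inv := by
      rw [← Scheme.Hom.appLE_comp_appLE _ _ V ⊤ ⊤ hV.fromSpec_preimage_self.ge le_top, h1,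
        Scheme.ΓSpecIso_inv_naturality, Scheme.Hom.appTop, Scheme.Hom.app_eq_appLE]
      rfl
    rw [Scheme.Hom.ker_apply]
    ext r
    rw [RingHom.mem_ker]
    let O := (Spec (.of (Γ(X, V) ⧸ I))).presheaf
    have h3 : i.app V r = 0 ↔ i.appLE V ⊤ hiV.ge r = 0 := by
      refine ⟨fun h ↦ ?_, fun h ↦ ?_⟩
      · rw [Scheme.Hom.appLE]
        exact (congrArg (O.map (homOfLE hiV.ge).op) h).trans
          (map_zero (O.map (homOfLE hiV.ge).op).hom)
      · rw [Scheme.Hom.app_eq_appLE, ← i.appLE_map (U := V) hiV.ge (homOfLE hiV.le).op]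
        exact (congrArg (O.map (homOfLE hiV.le).op) h).trans
          (map_zero (O.map (homOfLE hiV.le).op).hom)
    refine h3.trans ?_
    rw [h2]
    refine Iff.trans ?_ Ideal.Quotient.eq_zero_iff_mem
    exact map_eq_zero_iff (Scheme.ΓSpecIso (.of (Γ(X, V) ⧸ I))).inv.hom
      (Scheme.ΓSpecIso (.of (Γ(X, V) ⧸ I))).symm.commRingCatIsoToRingEquiv.injective
  · rw [Scheme.Hom.ker_apply]
    have h : i ⁻¹ᵁ W.1 = ⊥ := by
      refine le_bot_iff.1 fun x hx ↦ ?_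
      have h1 : Spec.map π x ∈ hV.fromSpec ⁻¹ᵁ X.basicOpen s := hU ⟨hW hx, hiV.ge trivial⟩
      rw [hV.fromSpec_preimage_basicOpen] at h1
      obtain ⟨n, hn⟩ := hs
      refine h1 (x.2.mem_of_pow_mem n ?_)
      change π s ^ n ∈ x.asIdeal
      rw [← map_pow, show π (s ^ n) = 0 from Ideal.Quotient.eq_zero_iff_mem.2 hn]
      exact x.asIdeal.zero_mem
    have : Subsingleton Γ(Spec (.of (Γ(X, V) ⧸ I)), i ⁻¹ᵁ W.1) := by
      rw [h]; infer_instance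
    exact (Ideal.eq_top_iff_one _).2 (Subsingleton.elim _ _)

lemma isLocalization_away_ι_app {V U : X.Opens} (hV : IsAffineOpen V) (s : Γ(X, V))
    (hU : U ⊓ V = X.basicOpen s) :
    letI := (U.ι.app V).hom.toAlgebra
    IsLocalization.Away s Γ(U.toScheme, U.ι ⁻¹ᵁ V) := by
  refine hV.isLocalization_of_eq_basicOpen s (V := U.ι ''ᵁ U.ι ⁻¹ᵁ V)
    (homOfLE (U.ι.image_preimage_le V)) ?_
  rw [← hU, Scheme.Hom.image_preimage_eq_opensRange_inf, Scheme.Opens.opensRange_ι]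

lemma isNowhereDense_closure_sdiff_basicOpen {V : X.Opens} (s : Γ(X, V))
    (hs : ∀ η ∈ genericPoints X, η ∈ V → η ∈ X.basicOpen s) :
    IsNowhereDense (closure ((V : Set X) \ X.basicOpen s)) := by
  rw [isClosed_closure.isNowhereDense_iff]
  by_contra hne
  obtain ⟨x, hx⟩ := Set.nonempty_iff_ne_empty.2 hne
  obtain ⟨y, hy, hyV, -⟩ := mem_closure_iff.1 (interior_subset hx) _ isOpen_interior hx
  obtain ⟨η, hη, hηy⟩ := exists_genericPoints_specializes y
  obtain ⟨z, hz, hz'⟩ := mem_closure_iff.1 (interior_subset (hηy.mem_open isOpen_interior hy)) _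
    (X.basicOpen s).2 (hs η hη (hηy.mem_open V.2 hyV))
  exact hz'.2 hz

/-- Each integral `b` is exhibited as a section of a suitable finite modification. By hypothesis
this is injective on field-valued points, so `b` belongs to the weak closure. -/
lemma isUniversalHomeomorphism_of_isTopologicallyNormal [IsNoetherian X]
    (h : IsTopologicallyNormal X) : IsUniversalHomeomorphism (normalizationMap X) := by
  rw [isUniversalHomeomorphism_normalizationMap_iff_weakClosure]
  intro V hV
  let := ((genericSchemeMap X).app V).hom.toAlgebra
  refine (weakClosure_le ..).antisymm fun b hb ↦ ?_
  obtain ⟨a, s, hs, hab⟩ := exists_genericSchemeMap_app_mul_eq hV b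
  -- The center has to be closed in `X`. Taking the closure adds no point of the basic open of `s`,
  -- so its complement meets `V` exactly in that basic open.
  let Z : Closeds X := ⟨closure ((V : Set X) \ X.basicOpen s), isClosed_closure⟩
  have hgen : ∀ η ∈ genericPoints X, η ∈ V → η ∈ X.basicOpen s := by
    intro η hη hηV
    obtain ⟨t, rfl⟩ := exists_genericSchemeMap_eq hη
    change t ∈ genericSchemeMap X ⁻¹ᵁ X.basicOpen s
    rw [Scheme.preimage_basicOpen, Scheme.basicOpen_of_isUnit _ hs]
    exact hηV
  have hZ : IsNowhereDense (Z : Set X) := isNowhereDense_closure_sdiff_basicOpen s hgen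
  let U : X.Opens := Z.compl
  have hU : U ⊓ V = X.basicOpen s := by
    ext x
    constructor
    · rintro ⟨hxU, hxV⟩
      by_contra hx
      exact hxU (subset_closure ⟨hxV, hx⟩)
    · refine fun hx ↦ ⟨fun hxZ ↦ ?_, X.basicOpen_le s hx⟩
      obtain ⟨y, hy, hy'⟩ := mem_closure_iff.1 hxZ _ (X.basicOpen s).2 hx
      exact hy'.2 hy
  have hrange : Set.range (genericSchemeMap X) ⊆ Set.range U.ι := by
    rintro _ ⟨t, rfl⟩
    rw [Scheme.Opens.range_ι]
    exact fun ht ↦ Set.disjoint_left.1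
      ((isNowhereDense_iff_disjoint_genericPoints Z.isClosed).1 hZ) (genericSchemeMap_mem t) ht
  let l : genericScheme X ⟶ U := IsOpenImmersion.lift U.ι (genericSchemeMap X) hrange
  have hl : genericSchemeMap X = l ≫ U.ι := (IsOpenImmersion.lift_fac _ _ _).symm
  let L := Γ(U.toScheme, U.ι ⁻¹ᵁ V)
  let ψ := l.appLE (U.ι ⁻¹ᵁ V) (genericSchemeMap X ⁻¹ᵁ V) (by rw [hl]; rfl)
  have hψ : U.ι.app V ≫ ψ = (genericSchemeMap X).app V := comp_appLE_eq_app l U.ι hl V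
  let j := (U.ι.app V).hom
  let := j.toAlgebra
  have hloc : IsLocalization.Away s L := isLocalization_away_ι_app hV s hU
  obtain ⟨c, hcb, n, hn⟩ := exists_lift_away_of_isIntegral (L := L) s a ψ.hom
    congr(($hψ).hom) (fun r hr ↦ isNilpotent_of_app_eq_zero (genericSchemeMap X) hV r hr) hb hab
  -- Asking for all powers of `c`, not just the first, makes `I` stable under multiplication by `c`;
  -- the common denominator `s ^ n` puts `s` in its radical.
  let I : Ideal Γ(X, V) :=
    { carrier := {r | ∀ k : ℕ, ∃ r', j r * c ^ k = j r'}
      zero_mem' := fun k ↦ ⟨0, by simp⟩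
      add_mem' := fun {x y} hx hy k ↦ by
        obtain ⟨x', hx'⟩ := hx k
        obtain ⟨y', hy'⟩ := hy k
        exact ⟨x' + y', by rw [map_add, add_mul, hx', hy', map_add]⟩
      smul_mem' := fun z x hx k ↦ by
        obtain ⟨x', hx'⟩ := hx k
        exact ⟨z * x', by rw [smul_eq_mul, map_mul, mul_assoc, hx', map_mul]⟩ }
  obtain ⟨J, hJ, hJU⟩ := exists_idealSheafData hV I s ⟨n, hn⟩ hU.le
  let S := multiplierSubalgebra U.ι J
  have hc : c ∈ S.sections ⟨V, hV⟩ := by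
    change c ∈ multiplierRing j (J.ideal ⟨V, hV⟩)
    rw [hJ]
    intro r hr
    obtain ⟨r', hr'⟩ := hr 1
    rw [pow_one] at hr'
    refine ⟨r', fun k ↦ ?_, by rw [mul_comm, hr']⟩
    obtain ⟨r'', h''⟩ := hr (k + 1)
    exact ⟨r'', by rw [← hr', mul_assoc, ← pow_succ', h'']⟩
  have hmod : IsFiniteModification S.toBase Z :=
    isFiniteModification_toBase_multiplierSubalgebra rfl hJU
  have := hmod.isFinite
  have hinj : UniversallyInjective S.toBase := (h Z hZ _ _ hmod).universallyInjective
  have hpt := (universallyInjective_iff_of_isAffineHom S.toBase).1 hinj V hV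
  let θ := S.fromSource.appLE (S.toBase ⁻¹ᵁ V) (U.ι ⁻¹ᵁ V) (S.preimage_le_fromSource_preimage V)
  have hθ : S.toBase.app V ≫ θ = U.ι.app V :=
    comp_appLE_eq_app S.fromSource S.toBase S.fromSource_toBase.symm V
  -- As a multiplier of `J`, `c` comes from a section `z` of the finite modification, and
  -- restricting `z` to the generic scheme gives `b`.
  obtain ⟨z, hz⟩ : c ∈ θ.hom.range := by
    rwa [S.range_fromSource_appLE ⟨V, hV⟩]
  have hmem := mem_weakClosure_of_pointInjective (R := Γ(X, V)) (S.toBase.app V).hom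
    (S.toBase.isIntegral_app V hV) hpt (θ ≫ ψ).hom (by
      refine congrArg CommRingCat.Hom.hom (?_ : S.toBase.app V ≫ θ ≫ ψ = (genericSchemeMap X).app V)
      rw [← Category.assoc, hθ, hψ]) z
  have hzb : (θ ≫ ψ).hom z = b := by
    rw [← hcb, ← hz]
    rfl
  rwa [hzb] at hmem

end NormalizationOfTopologicallyNormal

end TopNormal

end

theorem mainTheorem7 (X : Scheme.{u}) [IsNoetherian X] :
    (∃ (W : Scheme.{u}) (g : W ⟶ X), TopNormal.IsWeakNormalization g) ∧
    ∀ (W : Scheme.{u}) (g : W ⟶ X), TopNormal.IsWeakNormalization g →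
      List.TFAE [
        TopNormal.IsTopologicallyNormal X,
        TopNormal.IsGeometricallyUnibranch X,
        TopNormal.IsUniversalHomeomorphism (TopNormal.normalizationMap X),
        TopNormal.IsNormal W] := by
  have h0 := TopNormal.isWeakNormalization_weakNormalizationMap X
  refine ⟨⟨_, _, h0⟩, fun W g hg ↦ ?_⟩
  obtain ⟨e⟩ := hg.nonempty_iso h0
  tfae_have 1 → 3 := TopNormal.isUniversalHomeomorphism_of_isTopologicallyNormal
  tfae_have 3 → 1 := TopNormal.isTopologicallyNormal_of_isUniversalHomeomorphism
  tfae_have 2 ↔ 3 := TopNormal.isGeometricallyUnibranch_iff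
  tfae_have 4 → 3 := fun h ↦ TopNormal.isNormal_weakNormalization_iff.1 (h.of_iso e.symm)
  tfae_have 3 → 4 := fun h ↦ (TopNormal.isNormal_weakNormalization_iff.2 h).of_iso e
  tfae_finish
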